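/- Let $Q=[0,1]^2$, let $\sigma_f\in\mathbb R$, and let $z_f$ be Gaussian white noise on $Q$ with variance $\sigma_f^2$, i.e. a centred Gaussian family $\big(\iint_Q h\,z_f\,dx\,dy\big)_{h\in L^2(Q)}$ with covariance $\mathbb E\big[\iint_Q g z_f\iint_Q h z_f\big]=\sigma_f^2\langle g,h\rangle_{L^2(Q)}$. Let $f_0$ be a random (possibly deterministic) continuous function on $Q$, independent of $z_f$. Let $u$ be a measurable random field that solves $f_0=\Delta u+z_f$ with homogeneous Dirichlet boundary conditions, in either of the following two senses: (i) almost surely $u$ is continuous on $Q$ and $u=0$ on $\partial Q$, and for every $\eta\in C_c^\infty((0,1)^2)$, almost surely $\iint_Q f_0\,\eta=\iint_Q u\,\Delta\eta+\iint_Q\eta\, z_f$; or (ii) for every $(x,y)\in Q$, almost surely $$u(x,y)=u_0(x,y)-\iint_Q\psi\big((x',y')-(x,y)\big)\,z_f(x',y')\,dx'dy',\qquad \psi(x,y)=\frac{\ln\|(x,y)\|}{2\pi},$$ where $u_0$ is a measurable random field that is almost surely in $C^2((0,1)^2)\cap C(Q)$ with $\Delta u_0=f_0$ in $(0,1)^2$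 and $u_0=0$ on $\partial Q$ (so that $u(x,y)$ given $f_0$ has law $\mathcal N\big(u_0(x,y),\ \sigma_f^2\iint_Q\psi((x',y')-(x,y))^2dx'dy'\big)$). Then for all positive integers $n,m$ the sine coefficient $$\overline{u}^{(n,m)}=\iint_Q u(x,y)\sin(n\pi x)\sin(m\pi y)\,dx\,dy$$ is almost surely well defined (the paths of $u$ are integrable on $Q$), it is a random variable whose conditional law given $f_0$ almost surely has a finite second moment, and almost surely $$\operatorname{Var}\big[\overline{u}^{(n,m)}\mid f_0\big]\le\left(\frac{1}{\pi^2(n^2+m^2)}+\ln 2\,\max(n,m)\right)^2\sigma_f^2 .$$ -/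

import Mathlib

open MeasureTheory ProbabilityTheory Set

noncomputable section

/-- The closed unit square `[0,1]²`. -/
def unitSquare : Set (ℝ × ℝ) := Icc 0 1 ×ˢ Icc 0 1

/-- The space of (continuous) forcing functions carries its Borel `σ`-algebra for the sup norm. -/
instance instMeasurableSpaceForcing : MeasurableSpace C(unitSquare, ℝ) := borel _

instance instBorelSpaceForcing : BorelSpace C(unitSquare, ℝ) := ⟨rfl⟩

/-- The Laplacian `∂²g/∂x² + ∂²g/∂y²` of a function of two real variables. It is only applied at
points where the function is twice continuously differentiable. -/
def planeLaplacian (g : ℝ × ℝ → ℝ) (p : ℝ × ℝ) : ℝ :=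
  iteratedDeriv 2 (fun s => g (s, p.2)) p.1 + iteratedDeriv 2 (fun t => g (p.1, t)) p.2

/-- The fundamental solution `ψ(x, y) = ln ‖(x, y)‖ / (2π)` of the Laplacian in the plane, with the
Euclidean norm (the norm of `ℝ × ℝ` in Mathlib is the maximum norm). -/
def psi (p : ℝ × ℝ) : ℝ := Real.log (Real.sqrt (p.1 ^ 2 + p.2 ^ 2)) / (2 * Real.pi)

/-- The eigenfunction `sin(nπx) sin(mπy)`. -/
def sineMode (n m : ℕ) (p : ℝ × ℝ) : ℝ :=
  Real.sin (n * Real.pi * p.1) * Real.sin (m * Real.pi * p.2)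

/-- The Hilbert space `L²([0,1]²)`. -/
abbrev SquareL2 : Type := Lp ℝ 2 ((volume : Measure (ℝ × ℝ)).restrict unitSquare)

section Probability

variable {Ω : Type*} [MeasurableSpace Ω]

/-- `W` is Gaussian white noise of variance `σ²` on the unit square: the centred Gaussian process
indexed by `h ∈ L²([0,1]²)` (where `W h` stands for `∬ h z dx dy`) with covariance
`E[W g * W h] = σ² ⟪g, h⟫`. -/
structure IsWhiteNoise (P : Measure Ω) (σ : ℝ) (W : SquareL2 → Ω → ℝ) : Prop where
  measurable : ∀ h, Measurable (W h)
  gaussian : IsGaussianProcess W P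
  mean_zero : ∀ h, ∫ ω, W h ω ∂P = 0
  covariance : ∀ g h, cov[W g, W h; P] = σ ^ 2 * inner ℝ g h

open Classical in
/-- The stochastic integral `∬ g z dx dy` over the unit square of a square-integrable function `g`
against the white noise `z` (with the value `0` when `g` is not square-integrable). -/
def noiseIntegral (W : SquareL2 → Ω → ℝ) (g : ℝ × ℝ → ℝ) (ω : Ω) : ℝ :=
  if hg : MemLp g 2 ((volume : Measure (ℝ × ℝ)).restrict unitSquare) then W (hg.toLp g) ω else 0

/-- The sine coefficient `⟨u, sin(nπx) sin(mπy)⟩ = ∬ u(x, y) sin(nπx) sin(mπy) dx dy` of a random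
field `u`. -/
def sineCoeff (u : Ω → ℝ × ℝ → ℝ) (n m : ℕ) (ω : Ω) : ℝ :=
  ∫ p in unitSquare, u ω p * sineMode n m p

/-- `v` is a classical solution of `Δv = f` in the open square with `v = 0` on the boundary. -/
structure IsClassicalSolution (f : C(unitSquare, ℝ)) (v : ℝ × ℝ → ℝ) : Prop where
  contDiffOn : ContDiffOn ℝ 2 v (interior unitSquare)
  continuousOn : ContinuousOn v unitSquare
  boundary : ∀ p ∈ frontier unitSquare, v p = 0
  equation : ∀ p : unitSquare, (p : ℝ × ℝ) ∈ interior unitSquare → planeLaplacian v p = f p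

/-- The random field `u` solves `f = Δu + z` with `u = 0` on the boundary, where `z` is the white
noise `W`: `u` is almost surely continuous on the closed square and zero on its boundary, and the
equation holds in the sense of distributions on the open square. -/
structure IsDirichletSolution (P : Measure Ω) (W : SquareL2 → Ω → ℝ)
    (f : Ω → C(unitSquare, ℝ)) (u : Ω → ℝ × ℝ → ℝ) : Prop where
  measurable : Measurable (Function.uncurry u)
  continuousOn : ∀ᵐ ω ∂P, ContinuousOn (u ω) unitSquare
  boundary : ∀ᵐ ω ∂P, ∀ p ∈ frontier unitSquare, u ω p = 0
  equation : ∀ η : ℝ × ℝ → ℝ, ContDiff ℝ (⊤ : ℕ∞) η → HasCompactSupport η →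
    tsupport η ⊆ interior unitSquare →
    ∀ᵐ ω ∂P, ∫ p : unitSquare, f ω p * η p ∂(volume.comap Subtype.val) =
      (∫ p in unitSquare, u ω p * planeLaplacian η p) + noiseIntegral W η ω

/-- The random field `u` is the Newtonian-potential model of the solution of `f = Δu + z`, where
`z` is the white noise `W`: `u(p) = u₀(p) - ∬ ψ(q - p) z(q) dq` where `u₀` solves `Δu₀ = f` with
`u₀ = 0` on the boundary. Given `f`, the law of `u(p)` is thus the Gaussian law with mean `u₀(p)`
and variance `σ² ∬ ψ(q - p)² dq`. -/
structure IsNewtonianModel (P : Measure Ω) (W : SquareL2 → Ω → ℝ)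
    (f : Ω → C(unitSquare, ℝ)) (u₀ u : Ω → ℝ × ℝ → ℝ) : Prop where
  measurable : Measurable (Function.uncurry u)
  measurable_mean : Measurable (Function.uncurry u₀)
  mean_solution : ∀ᵐ ω ∂P, IsClassicalSolution (f ω) (u₀ ω)
  representation : ∀ p ∈ unitSquare,
    ∀ᵐ ω ∂P, u ω p = u₀ ω p - noiseIntegral W (fun q => psi (q - p)) ω

end Probability

end

/-!
Write `e` for `sineMode n m`, whose Laplacian is `-λ e` with `λ = π² (n² + m²)`. In both models the
sine coefficient of `u` is almost surely `-λ⁻¹ ⟨f₀, e⟩ + c W(h)` with a constant `c` and a fixed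
`h ∈ L²`. Since `W` is independent of `f₀`, the conditional law given `f₀ = g` is that of
`-λ⁻¹ ⟨g, e⟩ + c W(h)` (`condDistrib_add_of_indepFun`), and its variance is `c² σ² ‖h‖²`.

For a distributional solution, `h = e` and `c = λ⁻¹`, so the variance is at most `λ⁻² σ²`. The mode
`e` is not compactly supported, so the equation is tested against the cut-off modes
`χₖ(x) sin(nπx) χₖ(y) sin(mπy)`, with `χₖ` varying only at distance between `1/k` and `2/k` from the
end points. There the sine is of order `1/k`, so the Laplacian of the cut-off mode is of order `k`
on a layer of area of order `1/k`, where `u` is uniformly small; the layer does not contribute in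
the limit (`tendsto_integral_mul_planeLaplacian_cutoffMode`). The noise integrals converge in `L²`,
hence almost surely along a subsequence.

In the Newtonian model, `h` is the Newtonian potential `∬ ψ(q - p) e(p) dp` and `c = -1`. The
coefficient of `u₀` is `-λ⁻¹ ⟨f₀, e⟩`, by Green's formula for the cut-off modes and the same limit.
That of the noise part is `W(h)` by a stochastic Fubini theorem
(`IsWhiteNoise.average_ae_eq_noiseIntegral`), which needs only the covariance of `W`. Finally
`|h| ≤ ∬ |ψ(q - p)| dp ≤ log 2` (`abs_integral_psi_mul_le`), because `|log ‖(x, y)‖|` is at most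
`|log |x|| + (log 2) / 2` and the integral of `|log |x - a||` over `[0, 1]` is at most `2`.
-/

/-! ### Conditional laws of independent perturbations -/

section ConditionalLaw

variable {Ω β : Type*} [MeasurableSpace Ω] [MeasurableSpace β] {P : Measure Ω}
  [IsProbabilityMeasure P]

/-- If `X` is independent of `f`, then the conditional law of `F f + X` given `f = g` is the law of
`F g + X`. -/
lemma condDistrib_add_of_indepFun {f : Ω → β} (hf : Measurable f) {F : β → ℝ} (hF : Measurable F)
    {X Y : Ω → ℝ} (hX : Measurable X) (hY : Measurable Y) (hind : IndepFun f X P)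
    (hYX : Y =ᵐ[P] fun ω => F (f ω) + X ω) :
    ∀ᵐ g ∂(P.map f), condDistrib Y f P g = P.map (fun ω => F g + X ω) := by
  have hmeas : Measurable (fun p : β × ℝ => F p.1 + p.2) := by fun_prop
  have : IsProbabilityMeasure (P.map X) := Measure.isProbabilityMeasure_map hX.aemeasurable
  have : IsProbabilityMeasure (P.map f) := Measure.isProbabilityMeasure_map hf.aemeasurable
  let κ : Kernel β ℝ := (Kernel.id ×ₖ Kernel.const β (P.map X)).map (fun p => F p.1 + p.2)
  have hκ : ∀ g, κ g = P.map (fun ω => F g + X ω) := by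
    intro g
    have h1 : κ g = (((Kernel.id : Kernel β β) ×ₖ Kernel.const β (P.map X)) g).map
        (fun p => F p.1 + p.2) := Kernel.map_apply _ hmeas _
    rw [h1, Kernel.prod_apply, Kernel.id_apply, Kernel.const_apply, Measure.dirac_prod,
      Measure.map_map hmeas (by fun_prop), Measure.map_map (by fun_prop) hX]
    rfl
  have : IsMarkovKernel κ := Kernel.IsMarkovKernel.map _ hmeas
  have hjoint : P.map (fun ω => (f ω, Y ω)) = P.map f ⊗ₘ κ := by
    have hT : Measurable (fun p : β × ℝ => (p.1, F p.1 + p.2)) := by fun_prop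
    have h1 : P.map (fun ω => (f ω, Y ω)) =
        ((P.map f).prod (P.map X)).map (fun p : β × ℝ => (p.1, F p.1 + p.2)) := by
      rw [← (indepFun_iff_map_prod_eq_prod_map_map hf.aemeasurable hX.aemeasurable).1 hind,
        Measure.map_map hT (hf.prodMk hX)]
      refine Measure.map_congr ?_
      filter_upwards [hYX] with ω hω
      simp [hω]
    rw [h1]
    ext s hs
    rw [Measure.map_apply hT hs, Measure.prod_apply (hT hs), Measure.compProd_apply hs]
    refine lintegral_congr fun g => ?_
    rw [hκ, Measure.map_apply hX (by measurability),
      Measure.map_apply (by fun_prop) (by measurability)]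
    rfl
  filter_upwards [condDistrib_ae_eq_of_measure_eq_compProd f hY.aemeasurable hjoint] with g hg
  rw [hg, hκ]

lemma memLp_and_variance_condDistrib_of_indepFun {f : Ω → β} (hf : Measurable f) {F : β → ℝ}
    (hF : Measurable F) {X Y : Ω → ℝ} (hX : Measurable X) (hX2 : MemLp X 2 P) (hY : Measurable Y)
    (hind : IndepFun f X P) (hYX : Y =ᵐ[P] fun ω => F (f ω) + X ω) :
    ∀ᵐ g ∂(P.map f), MemLp id 2 (condDistrib Y f P g) ∧
      Var[id; condDistrib Y f P g] = Var[X; P] := by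
  filter_upwards [condDistrib_add_of_indepFun hf hF hX hY hind hYX] with g hg
  have hm : AEMeasurable (fun ω => F g + X ω) P := by fun_prop
  rw [hg]
  constructor
  · rw [memLp_map_measure_iff (by fun_prop) hm]
    exact (memLp_const (F g)).add hX2
  · rw [variance_id_map hm, variance_const_add hX.aestronglyMeasurable]

end ConditionalLaw

/-! ### Second-moment calculus of white noise -/

/-- Lebesgue measure on the unit square. -/
noncomputable abbrev squareMeasure : Measure (ℝ × ℝ) := (volume : Measure (ℝ × ℝ)).restrict unitSquare

lemma measurableSet_unitSquare : MeasurableSet unitSquare :=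
  measurableSet_Icc.prod measurableSet_Icc

instance isProbabilityMeasure_squareMeasure : IsProbabilityMeasure squareMeasure := by
  constructor
  rw [Measure.restrict_apply_univ, unitSquare, Measure.volume_eq_prod, Measure.prod_prod]
  simp

lemma integral_sub_sq_of_memLp_two {α : Type*} [MeasurableSpace α] {ν : Measure α} {a b : α → ℝ}
    (ha : MemLp a 2 ν) (hb : MemLp b 2 ν) :
    ∫ x, (a x - b x) ^ 2 ∂ν =
      ∫ x, a x * a x ∂ν - 2 * ∫ x, a x * b x ∂ν + ∫ x, b x * b x ∂ν := by
  have haa : Integrable (fun x => a x * a x) ν := ha.integrable_mul ha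
  have hab : Integrable (fun x => a x * b x) ν := ha.integrable_mul hb
  have hbb : Integrable (fun x => b x * b x) ν := hb.integrable_mul hb
  have h1 : ∫ x, a x * a x ∂ν - 2 * ∫ x, a x * b x ∂ν + ∫ x, b x * b x ∂ν =
      ∫ x, (a x * a x - 2 * (a x * b x) + b x * b x) ∂ν := by
    rw [integral_add (by exact haa.sub (hab.const_mul 2)) hbb,
      integral_sub haa (hab.const_mul 2), integral_const_mul]
  rw [h1]
  refine integral_congr_ae (Filter.Eventually.of_forall fun x => ?_)
  ring

lemma noiseIntegral_of_memLp {Ω : Type*} {W : SquareL2 → Ω → ℝ} {g : ℝ × ℝ → ℝ}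
    (hg : MemLp g 2 squareMeasure) :
    noiseIntegral W g = W (hg.toLp g) := by
  ext ω
  simp [noiseIntegral, hg]

section WhiteNoise

variable {Ω : Type*} [MeasurableSpace Ω] {P : Measure Ω} {σ : ℝ} {W : SquareL2 → Ω → ℝ}

lemma IsWhiteNoise.measurable_noiseIntegral (hW : IsWhiteNoise P σ W) (g : ℝ × ℝ → ℝ) :
    Measurable (noiseIntegral W g) := by
  by_cases hg : MemLp g 2 squareMeasure
  · rw [noiseIntegral_of_memLp hg]
    exact hW.measurable _
  · have : noiseIntegral W g = fun _ => 0 := by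
      ext ω
      simp [noiseIntegral, hg]
    rw [this]
    exact measurable_const

lemma indepFun_noiseIntegral {β : Type*} [MeasurableSpace β] {f : Ω → β}
    (hind : IndepFun f (fun ω h => W h ω) P) {g : ℝ × ℝ → ℝ} (hg : MemLp g 2 squareMeasure) :
    IndepFun f (noiseIntegral W g) P := by
  rw [noiseIntegral_of_memLp hg]
  exact hind.comp measurable_id (measurable_pi_apply (hg.toLp g))

lemma IsWhiteNoise.memLp_two (hW : IsWhiteNoise P σ W) (h : SquareL2) : MemLp (W h) 2 P :=
  (hW.gaussian.hasGaussianLaw_eval h).memLp_two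

lemma IsWhiteNoise.memLp_noiseIntegral (hW : IsWhiteNoise P σ W) {g : ℝ × ℝ → ℝ}
    (hg : MemLp g 2 squareMeasure) : MemLp (noiseIntegral W g) 2 P := by
  rw [noiseIntegral_of_memLp hg]
  exact hW.memLp_two _

variable [IsProbabilityMeasure P]

lemma IsWhiteNoise.integral_mul_noiseIntegral (hW : IsWhiteNoise P σ W) {g h : ℝ × ℝ → ℝ}
    (hg : MemLp g 2 squareMeasure) (hh : MemLp h 2 squareMeasure) :
    ∫ ω, noiseIntegral W g ω * noiseIntegral W h ω ∂P =
      σ ^ 2 * ∫ q, g q * h q ∂squareMeasure := by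
  rw [noiseIntegral_of_memLp hg, noiseIntegral_of_memLp hh]
  have h1 := hW.covariance (hg.toLp g) (hh.toLp h)
  rw [covariance_eq_sub (hW.memLp_two _) (hW.memLp_two _)] at h1
  simp only [hW.mean_zero, mul_zero, sub_zero, Pi.mul_apply] at h1
  rw [h1, L2.inner_def]
  congr 1
  refine integral_congr_ae ?_
  filter_upwards [hg.coeFn_toLp, hh.coeFn_toLp] with q h1 h2
  simp [h1, h2, mul_comm]

lemma IsWhiteNoise.variance_noiseIntegral (hW : IsWhiteNoise P σ W) {g : ℝ × ℝ → ℝ}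
    (hg : MemLp g 2 squareMeasure) :
    Var[noiseIntegral W g; P] = σ ^ 2 * ∫ q, g q ^ 2 ∂squareMeasure := by
  rw [variance_eq_sub (hW.memLp_noiseIntegral hg)]
  have h0 : ∫ ω, noiseIntegral W g ω ∂P = 0 := by
    rw [noiseIntegral_of_memLp hg]
    exact hW.mean_zero _
  have h1 := hW.integral_mul_noiseIntegral hg hg
  simp only [← pow_two] at h1
  simpa [h0] using h1

lemma IsWhiteNoise.integral_sub_sq_noiseIntegral (hW : IsWhiteNoise P σ W) {g h : ℝ × ℝ → ℝ}
    (hg : MemLp g 2 squareMeasure) (hh : MemLp h 2 squareMeasure) :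
    ∫ ω, (noiseIntegral W g ω - noiseIntegral W h ω) ^ 2 ∂P =
      σ ^ 2 * ∫ q, (g q - h q) ^ 2 ∂squareMeasure := by
  rw [integral_sub_sq_of_memLp_two (hW.memLp_noiseIntegral hg) (hW.memLp_noiseIntegral hh),
    hW.integral_mul_noiseIntegral hg hg, hW.integral_mul_noiseIntegral hg hh,
    hW.integral_mul_noiseIntegral hh hh]
  rw [integral_sub_sq_of_memLp_two hg hh]
  ring

end WhiteNoise

/-! ### A stochastic Fubini theorem -/

section Averages

variable {α β : Type*} [MeasurableSpace α] [MeasurableSpace β] {ν : Measure α} {μ : Measure β}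

/-- A measurable function on a product is square-integrable if its sections are, with a uniform
bound. -/
lemma memLp_two_prod_of_integral_sq_le [IsFiniteMeasure ν] [IsFiniteMeasure μ] {F : α × β → ℝ}
    (hF : Measurable F) {C : ℝ}
    (h : ∀ᵐ y ∂μ, MemLp (fun x => F (x, y)) 2 ν ∧ ∫ x, F (x, y) ^ 2 ∂ν ≤ C) :
    MemLp F 2 (ν.prod μ) := by
  rw [memLp_two_iff_integrable_sq hF.aestronglyMeasurable,
    integrable_prod_iff' (by fun_prop)]
  constructor
  · filter_upwards [h] with y hy
    exact hy.1.integrable_sq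
  · refine Integrable.mono' (integrable_const C) ?_ ?_
    · have : StronglyMeasurable (Function.uncurry fun (y : β) (x : α) => ‖F (x, y) ^ 2‖) := by
        apply Measurable.stronglyMeasurable
        exact ((hF.comp measurable_swap).pow_const 2).norm
      exact this.integral_prod_right.aestronglyMeasurable
    · filter_upwards [h] with y hy
      rw [Real.norm_of_nonneg (integral_nonneg fun x => norm_nonneg _)]
      simpa using hy.2

variable {F : α × β → ℝ} {e : β → ℝ}

lemma measurable_average [SFinite μ] (hF : Measurable F) (he : Measurable e) :
    Measurable (fun x => ∫ y, F (x, y) * e y ∂μ) := by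
  have : StronglyMeasurable (Function.uncurry fun (x : α) (y : β) => F (x, y) * e y) := by
    apply Measurable.stronglyMeasurable
    exact hF.mul (he.comp measurable_snd)
  exact this.integral_prod_right.measurable

lemma ae_memLp_two_section [SFinite ν] [SFinite μ] (hF : Measurable F)
    (hF2 : MemLp F 2 (ν.prod μ)) : ∀ᵐ x ∂ν, MemLp (fun y => F (x, y)) 2 μ := by
  filter_upwards [hF2.integrable_sq.prod_right_ae] with x hx
  have hm : Measurable (fun y => F (x, y)) := hF.comp measurable_prodMk_left
  exact (memLp_two_iff_integrable_sq hm.aestronglyMeasurable).2 hx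

lemma sq_integral_mul_le [IsProbabilityMeasure μ] {g : β → ℝ} (hg : MemLp g 2 μ)
    (he : Measurable e) (he1 : ∀ y, |e y| ≤ 1) :
    (∫ y, g y * e y ∂μ) ^ 2 ≤ ∫ y, g y ^ 2 ∂μ := by
  have hge : MemLp (fun y => g y * e y) 2 μ := by
    refine hg.of_le (hg.1.mul he.aestronglyMeasurable) (Filter.Eventually.of_forall fun y => ?_)
    rw [norm_mul]
    exact mul_le_of_le_one_right (norm_nonneg _) (he1 y)
  have h1 := variance_nonneg (fun y => g y * e y) μ
  rw [variance_eq_sub hge] at h1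
  refine (sub_nonneg.1 h1).trans ?_
  refine integral_mono hge.integrable_sq hg.integrable_sq fun y => ?_
  have h2 : (e y) ^ 2 ≤ 1 := (sq_le_one_iff_abs_le_one _).2 (he1 y)
  simp only [Pi.pow_apply, mul_pow]
  exact mul_le_of_le_one_right (sq_nonneg _) h2

lemma memLp_two_average [SFinite ν] [IsProbabilityMeasure μ] (hF : Measurable F)
    (hF2 : MemLp F 2 (ν.prod μ)) (he : Measurable e) (he1 : ∀ y, |e y| ≤ 1) :
    MemLp (fun x => ∫ y, F (x, y) * e y ∂μ) 2 ν := by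
  have hm := measurable_average (μ := μ) hF he
  rw [memLp_two_iff_integrable_sq hm.aestronglyMeasurable]
  refine Integrable.mono' hF2.integrable_sq.integral_prod_left
    (hm.pow_const 2).aestronglyMeasurable ?_
  filter_upwards [ae_memLp_two_section hF hF2] with x hx
  rw [Real.norm_of_nonneg (sq_nonneg _)]
  exact sq_integral_mul_le hx he he1

lemma integral_average_mul [IsFiniteMeasure ν] [IsFiniteMeasure μ]
    (hF2 : MemLp F 2 (ν.prod μ)) (he : Measurable e) (he1 : ∀ y, |e y| ≤ 1) {X : α → ℝ}
    (hX : MemLp X 2 ν) :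
    ∫ x, (∫ y, F (x, y) * e y ∂μ) * X x ∂ν = ∫ y, e y * ∫ x, F (x, y) * X x ∂ν ∂μ := by
  simp only [← integral_mul_const, ← integral_const_mul]
  rw [integral_integral_swap]
  · refine integral_congr_ae (Filter.Eventually.of_forall fun y => ?_)
    refine integral_congr_ae (Filter.Eventually.of_forall fun x => ?_)
    ring
  · have h1 : Integrable (fun p : α × β => F p * X p.1) (ν.prod μ) :=
      hF2.integrable_mul (hX.comp_fst μ)
    refine (h1.bdd_mul (c := 1) (f := fun p : α × β => e p.2)
      (he.comp measurable_snd).aestronglyMeasurable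
      (Filter.Eventually.of_forall fun p => he1 p.2)).congr
      (Filter.Eventually.of_forall fun p => ?_)
    simp only [Function.uncurry]
    ring

end Averages

section StochasticFubini

variable {Ω : Type*} [MeasurableSpace Ω] {P : Measure Ω} [IsProbabilityMeasure P] {σ : ℝ}
  {W : SquareL2 → Ω → ℝ}

lemma IsWhiteNoise.memLp_two_field (hW : IsWhiteNoise P σ W) {Z : Ω × (ℝ × ℝ) → ℝ}
    (hZ : Measurable Z) {K : (ℝ × ℝ) × (ℝ × ℝ) → ℝ} {C : ℝ}
    (hKC : ∀ᵐ p ∂squareMeasure, MemLp (fun q => K (q, p)) 2 squareMeasure ∧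
      ∫ q, K (q, p) ^ 2 ∂squareMeasure ≤ C)
    (hZK : ∀ᵐ p ∂squareMeasure, (fun ω => Z (ω, p)) =ᵐ[P] noiseIntegral W (fun q => K (q, p))) :
    MemLp Z 2 (P.prod squareMeasure) := by
  refine memLp_two_prod_of_integral_sq_le hZ (C := σ ^ 2 * C) ?_
  filter_upwards [hKC, hZK] with p hp1 hp2
  refine ⟨(memLp_congr_ae hp2).2 (hW.memLp_noiseIntegral hp1.1), ?_⟩
  have h1 := hW.integral_mul_noiseIntegral hp1.1 hp1.1
  simp only [← pow_two] at h1
  have h2 : ∫ ω, Z (ω, p) ^ 2 ∂P = ∫ ω, noiseIntegral W (fun q => K (q, p)) ω ^ 2 ∂P := by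
    refine integral_congr_ae ?_
    filter_upwards [hp2] with ω hω
    rw [hω]
  rw [h2, h1]
  exact mul_le_mul_of_nonneg_left hp1.2 (sq_nonneg σ)

/-- If the field `Z` is at almost every `p` the white-noise integral of `K (·, p)`, then its
weighted average over the square is the white-noise integral of the average of `K`. The difference
`R` of the two sides is orthogonal in `L²(P)` to every white-noise integral, hence to both sides,
hence to itself; linearity of `W` is not used. -/
lemma IsWhiteNoise.average_ae_eq_noiseIntegral (hW : IsWhiteNoise P σ W) {Z : Ω × (ℝ × ℝ) → ℝ}
    (hZ : Measurable Z) {K : (ℝ × ℝ) × (ℝ × ℝ) → ℝ} (hK : Measurable K) {C : ℝ}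
    (hKC : ∀ᵐ p ∂squareMeasure, MemLp (fun q => K (q, p)) 2 squareMeasure ∧
      ∫ q, K (q, p) ^ 2 ∂squareMeasure ≤ C)
    (hZK : ∀ᵐ p ∂squareMeasure, (fun ω => Z (ω, p)) =ᵐ[P] noiseIntegral W (fun q => K (q, p)))
    {e : ℝ × ℝ → ℝ} (he : Measurable e) (he1 : ∀ p, |e p| ≤ 1) :
    (fun ω => ∫ p, Z (ω, p) * e p ∂squareMeasure) =ᵐ[P]
      noiseIntegral W (fun q => ∫ p, K (q, p) * e p ∂squareMeasure) := by
  have hZ2 := hW.memLp_two_field hZ hKC hZK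
  have hK2 := memLp_two_prod_of_integral_sq_le hK hKC
  set h : ℝ × ℝ → ℝ := fun q => ∫ p, K (q, p) * e p ∂squareMeasure with hh
  have hh2 : MemLp h 2 squareMeasure := memLp_two_average hK hK2 he he1
  set Y : Ω → ℝ := fun ω => ∫ p, Z (ω, p) * e p ∂squareMeasure with hY
  have hY2 : MemLp Y 2 P := memLp_two_average hZ hZ2 he he1
  have hN2 : MemLp (noiseIntegral W h) 2 P := hW.memLp_noiseIntegral hh2
  have hYN : ∀ g : ℝ × ℝ → ℝ, MemLp g 2 squareMeasure →
      ∫ ω, Y ω * noiseIntegral W g ω ∂P = σ ^ 2 * ∫ q, h q * g q ∂squareMeasure := by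
    intro g hg
    rw [integral_average_mul hZ2 he he1 (hW.memLp_noiseIntegral hg),
      integral_average_mul hK2 he he1 hg, ← integral_const_mul]
    refine integral_congr_ae ?_
    filter_upwards [hKC, hZK] with p hp1 hp2
    have h1 := hW.integral_mul_noiseIntegral hp1.1 hg
    have h2 : ∫ ω, Z (ω, p) * noiseIntegral W g ω ∂P =
        ∫ ω, noiseIntegral W (fun q => K (q, p)) ω * noiseIntegral W g ω ∂P := by
      refine integral_congr_ae ?_
      filter_upwards [hp2] with ω hω
      rw [hω]
    rw [h2, h1]
    ring
  set R : Ω → ℝ := fun ω => Y ω - noiseIntegral W h ω with hR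
  have hR2 : MemLp R 2 P := hY2.sub hN2
  have hNR : ∀ g : ℝ × ℝ → ℝ, MemLp g 2 squareMeasure →
      ∫ ω, noiseIntegral W g ω * R ω ∂P = 0 := by
    intro g hg
    have hg2 := hW.memLp_noiseIntegral hg
    have h1 : ∫ ω, noiseIntegral W g ω * R ω ∂P =
        ∫ ω, Y ω * noiseIntegral W g ω ∂P -
          ∫ ω, noiseIntegral W h ω * noiseIntegral W g ω ∂P := by
      rw [← integral_sub (by exact hY2.integrable_mul hg2) (by exact hN2.integrable_mul hg2)]
      refine integral_congr_ae (Filter.Eventually.of_forall fun ω => ?_)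
      simp only [hR]
      ring
    rw [h1, hYN g hg, hW.integral_mul_noiseIntegral hh2 hg, sub_self]
  have hYR : ∫ ω, Y ω * R ω ∂P = 0 := by
    rw [integral_average_mul hZ2 he he1 hR2]
    refine integral_eq_zero_of_ae ?_
    filter_upwards [hKC, hZK] with p hp1 hp2
    have h2 : ∫ ω, Z (ω, p) * R ω ∂P = ∫ ω, noiseIntegral W (fun q => K (q, p)) ω * R ω ∂P := by
      refine integral_congr_ae ?_
      filter_upwards [hp2] with ω hω
      rw [hω]
    rw [h2, hNR _ hp1.1]
    simp
  have hRR : ∫ ω, R ω ^ 2 ∂P = 0 := by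
    have h1 : ∫ ω, R ω ^ 2 ∂P =
        ∫ ω, Y ω * R ω ∂P - ∫ ω, noiseIntegral W h ω * R ω ∂P := by
      rw [← integral_sub (by exact hY2.integrable_mul hR2) (by exact hN2.integrable_mul hR2)]
      refine integral_congr_ae (Filter.Eventually.of_forall fun ω => ?_)
      simp only [hR]
      ring
    rw [h1, hYR, hNR h hh2, sub_self]
  rw [integral_eq_zero_iff_of_nonneg (fun ω => sq_nonneg _) hR2.integrable_sq] at hRR
  filter_upwards [hRR] with ω hω
  have : R ω ^ 2 = 0 := hω
  have h0 : R ω = 0 := by simpa using this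
  exact sub_eq_zero.1 h0

end StochasticFubini

/-! ### Bounds for the logarithmic kernel -/

lemma squareMeasure_eq_prod :
    squareMeasure = ((volume : Measure ℝ).restrict (Icc 0 1)).prod
      ((volume : Measure ℝ).restrict (Icc 0 1)) := by
  rw [Measure.prod_restrict, ← Measure.volume_eq_prod]
  rfl

instance isProbabilityMeasure_restrict_Icc_zero_one :
    IsProbabilityMeasure ((volume : Measure ℝ).restrict (Icc 0 1)) := by
  constructor
  simp

lemma integral_squareMeasure_fst (g : ℝ → ℝ) :
    ∫ q, g q.1 ∂squareMeasure = ∫ x in Icc (0 : ℝ) 1, g x := by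
  rw [squareMeasure_eq_prod, integral_fun_fst]
  simp

/-- Near `0`, `log² t` is dominated by a multiple of `t ^ (-1/2)`. -/
lemma intervalIntegrable_log_sq_zero_one :
    IntervalIntegrable (fun t => Real.log t ^ 2) volume 0 1 := by
  have h := (intervalIntegral.intervalIntegrable_rpow' (a := 0) (b := 1) (r := -(1 / 2))
    (by norm_num)).const_mul 16
  refine h.mono_fun (Real.measurable_log.pow_const 2).aestronglyMeasurable ?_
  rw [uIoc_of_le zero_le_one]
  refine (ae_restrict_iff' measurableSet_Ioc).2 (Filter.Eventually.of_forall fun t ht => ?_)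
  have h1 := (Real.abs_log_mul_self_rpow_lt t (1 / 4) ht.1 ht.2 (by norm_num)).le
  have h3 : 0 < t ^ (1 / 4 : ℝ) := Real.rpow_pos_of_pos ht.1 _
  have h4 : t ^ (-(1 / 2) : ℝ) * (t ^ (1 / 4 : ℝ)) ^ 2 = 1 := by
    rw [← Real.rpow_natCast, ← Real.rpow_mul ht.1.le, ← Real.rpow_add ht.1]
    norm_num
  have h5 : 0 < t ^ (-(1 / 2) : ℝ) := Real.rpow_pos_of_pos ht.1 _
  have h6 : (Real.log t * t ^ (1 / 4 : ℝ)) ^ 2 ≤ 16 := by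
    rw [← sq_abs]
    refine (pow_le_pow_left₀ (abs_nonneg _) h1 2).trans ?_
    norm_num
  beta_reduce
  rw [Real.norm_of_nonneg (sq_nonneg _), Real.norm_of_nonneg (by positivity)]
  calc Real.log t ^ 2 = (Real.log t * t ^ (1 / 4 : ℝ)) ^ 2 * t ^ (-(1 / 2) : ℝ) := by
        rw [mul_pow, mul_assoc, mul_comm (_ ^ 2) (t ^ (-(1 / 2) : ℝ)), h4, mul_one]
    _ ≤ 16 * t ^ (-(1 / 2) : ℝ) := by gcongr

lemma intervalIntegrable_log_sq : IntervalIntegrable (fun t => Real.log t ^ 2) volume (-1) 1 := by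
  have h := intervalIntegrable_log_sq_zero_one
  have h2 := h.comp_mul_left (c := -1)
  simp only [neg_mul, one_mul, Real.log_neg_eq_log, div_neg, div_one, neg_zero] at h2
  exact h2.symm.trans h

/-- The one-dimensional majorant of the logarithmic kernel is square-integrable. -/
lemma integrableOn_abs_log_add_one_sq :
    IntegrableOn (fun t => (|Real.log t| + 1) ^ 2) (Icc (-1) 1) := by
  rw [← intervalIntegrable_iff_integrableOn_Icc_of_le (by norm_num)]
  have h1 : IntervalIntegrable (fun t => 2 * Real.log t ^ 2 + 2) volume (-1) 1 :=
    (intervalIntegrable_log_sq.const_mul 2).add intervalIntegrable_const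
  refine h1.mono_fun
    ((Real.measurable_log.abs.add_const 1).pow_const 2).aestronglyMeasurable
    (Filter.Eventually.of_forall fun t => ?_)
  have h2 := sq_abs (Real.log t)
  beta_reduce
  rw [Real.norm_of_nonneg (by positivity), Real.norm_of_nonneg (by positivity)]
  nlinarith [sq_nonneg (|Real.log t| - 1)]

lemma integrableOn_Icc_comp_sub {g : ℝ → ℝ} (hg : IntegrableOn g (Icc (-1) 1)) {a : ℝ}
    (ha : a ∈ Icc (0 : ℝ) 1) : IntegrableOn (fun x => g (x - a)) (Icc 0 1) := by
  rw [← intervalIntegrable_iff_integrableOn_Icc_of_le (by norm_num)] at hg ⊢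
  have h1 : IntervalIntegrable g volume (0 - a) (1 - a) := by
    refine hg.mono_set ?_
    rw [uIcc_of_le (by linarith), uIcc_of_le (by norm_num)]
    exact Icc_subset_Icc (by linarith [ha.2]) (by linarith [ha.1])
  have h2 := h1.comp_sub_right a
  simpa using h2

lemma setIntegral_Icc_comp_sub (g : ℝ → ℝ) (a : ℝ) :
    ∫ x in Icc (0 : ℝ) 1, g (x - a) = ∫ t in (0 - a)..(1 - a), g t := by
  rw [integral_Icc_eq_integral_Ioc, ← intervalIntegral.integral_of_le zero_le_one,
    intervalIntegral.integral_comp_sub_right]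

lemma setIntegral_Icc_comp_sub_le {g : ℝ → ℝ} (hg0 : ∀ t, 0 ≤ g t)
    (hg : IntegrableOn g (Icc (-1) 1)) {a : ℝ} (ha : a ∈ Icc (0 : ℝ) 1) :
    ∫ x in Icc (0 : ℝ) 1, g (x - a) ≤ ∫ t in Icc (-1) 1, g t := by
  rw [setIntegral_Icc_comp_sub, intervalIntegral.integral_of_le (by linarith)]
  refine setIntegral_mono_set hg (Filter.Eventually.of_forall hg0) ?_
  refine LE.le.eventuallyLE ?_
  exact Ioc_subset_Icc_self.trans (Icc_subset_Icc (by linarith [ha.2]) (by linarith [ha.1]))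

lemma sub_one_le_mul_log {x : ℝ} (hx : 0 ≤ x) : x - 1 ≤ x * Real.log x := by
  rcases hx.eq_or_lt with rfl | hx
  · simp
  · have h := mul_le_mul_of_nonneg_left (Real.one_sub_inv_le_log_of_pos hx) hx.le
    rwa [mul_sub, mul_inv_cancel₀ hx.ne', mul_one] at h

lemma integral_abs_log_sub_le {a : ℝ} (ha : a ∈ Icc (0 : ℝ) 1) :
    ∫ x in Icc (0 : ℝ) 1, |Real.log (x - a)| ≤ 2 := by
  rw [setIntegral_Icc_comp_sub (fun t => |Real.log t|)]
  have h1 : ∫ t in (0 - a)..(1 - a), |Real.log t| = ∫ t in (0 - a)..(1 - a), -Real.log t := by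
    refine intervalIntegral.integral_congr fun t ht => ?_
    rw [uIcc_of_le (by linarith)] at ht
    refine abs_of_nonpos ?_
    rw [← Real.log_abs]
    refine Real.log_nonpos (abs_nonneg t) (abs_le.2 ⟨?_, ?_⟩) <;> linarith [ht.1, ht.2, ha.1, ha.2]
  rw [h1, intervalIntegral.integral_neg, integral_log, zero_sub, Real.log_neg_eq_log]
  have h2 := sub_one_le_mul_log ha.1
  have h3 := sub_one_le_mul_log (sub_nonneg.2 ha.2)
  linarith

/-- The logarithm of the Euclidean norm is dominated by that of the first coordinate. -/
lemma abs_psi_le {p : ℝ × ℝ} (h0 : p.1 ≠ 0) (h1 : |p.1| ≤ 1) (h2 : |p.2| ≤ 1) :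
    |psi p| ≤ (|Real.log p.1| + Real.log 2 / 2) / (2 * Real.pi) := by
  have hpos : 0 < p.1 ^ 2 + p.2 ^ 2 := by positivity
  rw [psi, abs_div, abs_of_pos (by positivity : 0 < 2 * Real.pi)]
  gcongr
  have hl2 : 0 < Real.log 2 := Real.log_pos one_lt_two
  rw [abs_le]
  constructor
  · have h3 : Real.log |p.1| ≤ Real.log (Real.sqrt (p.1 ^ 2 + p.2 ^ 2)) :=
      Real.log_le_log (abs_pos.2 h0) (Real.abs_le_sqrt (by nlinarith [sq_nonneg p.2]))
    rw [Real.log_abs] at h3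
    linarith [neg_abs_le (Real.log p.1)]
  · rw [Real.log_sqrt hpos.le]
    have h3 : Real.log (p.1 ^ 2 + p.2 ^ 2) ≤ Real.log 2 := by
      refine Real.log_le_log hpos ?_
      have := (sq_le_one_iff_abs_le_one p.1).2 h1
      have := (sq_le_one_iff_abs_le_one p.2).2 h2
      linarith
    linarith [abs_nonneg (Real.log p.1)]

lemma measurable_psi : Measurable psi := by
  unfold psi
  fun_prop

lemma psi_neg (p : ℝ × ℝ) : psi (-p) = psi p := by
  simp [psi]

lemma ae_abs_psi_sub_le {p : ℝ × ℝ} (hp : p ∈ unitSquare) :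
    ∀ᵐ q ∂squareMeasure,
      |psi (q - p)| ≤ (|Real.log (q.1 - p.1)| + Real.log 2 / 2) / (2 * Real.pi) := by
  have h1 : ∀ᵐ q ∂squareMeasure, q.1 ≠ p.1 := by
    rw [squareMeasure_eq_prod]
    exact Measure.quasiMeasurePreserving_fst.ae
      (p := fun x => x ≠ p.1) (ae_restrict_of_ae (Measure.ae_ne volume p.1))
  filter_upwards [h1, ae_restrict_mem measurableSet_unitSquare] with q hq1 hq
  refine abs_psi_le (sub_ne_zero.2 hq1) ?_ ?_
  · exact abs_le.2 ⟨by simp only [Prod.fst_sub]; linarith [hq.1.1, hp.1.2],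
      by simp only [Prod.fst_sub]; linarith [hq.1.2, hp.1.1]⟩
  · exact abs_le.2 ⟨by simp only [Prod.snd_sub]; linarith [hq.2.1, hp.2.2],
      by simp only [Prod.snd_sub]; linarith [hq.2.2, hp.2.1]⟩

/-- The kernels `ψ(· - p)` are bounded in `L²([0,1]²)` uniformly in `p ∈ [0,1]²`. -/
lemma memLp_two_psi_sub {p : ℝ × ℝ} (hp : p ∈ unitSquare) :
    MemLp (fun q => psi (q - p)) 2 squareMeasure ∧
      ∫ q, psi (q - p) ^ 2 ∂squareMeasure ≤ ∫ t in Icc (-1) 1, (|Real.log t| + 1) ^ 2 := by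
  have hm : Measurable (fun q => psi (q - p)) := measurable_psi.comp (by fun_prop)
  have hint : Integrable (fun q : ℝ × ℝ => (|Real.log (q.1 - p.1)| + 1) ^ 2) squareMeasure := by
    rw [squareMeasure_eq_prod]
    exact (integrableOn_Icc_comp_sub integrableOn_abs_log_add_one_sq hp.1).comp_fst _
  have hle : ∀ᵐ q ∂squareMeasure, psi (q - p) ^ 2 ≤ (|Real.log (q.1 - p.1)| + 1) ^ 2 := by
    filter_upwards [ae_abs_psi_sub_le hp] with q hq
    rw [← sq_abs]
    refine pow_le_pow_left₀ (abs_nonneg _) (hq.trans ?_) 2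
    refine (div_le_self (by positivity) (by linarith [Real.pi_gt_three])).trans ?_
    linarith [Real.log_two_lt_d9]
  have hsq : Integrable (fun q => psi (q - p) ^ 2) squareMeasure := by
    refine hint.mono' (hm.pow_const 2).aestronglyMeasurable ?_
    filter_upwards [hle] with q hq
    rwa [Real.norm_of_nonneg (sq_nonneg _)]
  refine ⟨(memLp_two_iff_integrable_sq hm.aestronglyMeasurable).2 hsq, ?_⟩
  refine (integral_mono_ae hsq hint hle).trans ?_
  rw [integral_squareMeasure_fst (fun x => (|Real.log (x - p.1)| + 1) ^ 2)]
  exact setIntegral_Icc_comp_sub_le (g := fun t => (|Real.log t| + 1) ^ 2)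
    (fun t => by positivity) integrableOn_abs_log_add_one_sq hp.1

/-- The Newtonian potential of a function bounded by `1` is bounded by `log 2` on the square. -/
lemma abs_integral_psi_mul_le {q : ℝ × ℝ} (hq : q ∈ unitSquare) {e : ℝ × ℝ → ℝ}
    (he1 : ∀ p, |e p| ≤ 1) : |∫ p, psi (q - p) * e p ∂squareMeasure| ≤ Real.log 2 := by
  have hlog : IntegrableOn (fun x => |Real.log (x - q.1)|) (Icc 0 1) := by
    refine integrableOn_Icc_comp_sub (g := fun t => |Real.log t|) ?_ hq.1
    rw [← intervalIntegrable_iff_integrableOn_Icc_of_le (by norm_num)]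
    exact intervalIntegral.intervalIntegrable_log'.abs
  have hint : Integrable
      (fun x => (|Real.log (x - q.1)| + Real.log 2 / 2) / (2 * Real.pi))
      ((volume : Measure ℝ).restrict (Icc 0 1)) :=
    (hlog.add (integrable_const _)).div_const _
  have hint2 : Integrable (fun p : ℝ × ℝ =>
      (|Real.log (p.1 - q.1)| + Real.log 2 / 2) / (2 * Real.pi)) squareMeasure := by
    rw [squareMeasure_eq_prod]
    exact hint.comp_fst _
  have h1 : |∫ p, psi (q - p) * e p ∂squareMeasure| ≤
      ∫ p, (|Real.log (p.1 - q.1)| + Real.log 2 / 2) / (2 * Real.pi) ∂squareMeasure := by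
    refine norm_integral_le_of_norm_le (f := fun p => psi (q - p) * e p) hint2 ?_
    filter_upwards [ae_abs_psi_sub_le hq] with p hp
    rw [← psi_neg, neg_sub, norm_mul]
    exact (mul_le_of_le_one_right (norm_nonneg _) (he1 p)).trans hp
  refine h1.trans ?_
  rw [integral_squareMeasure_fst
    (fun x => (|Real.log (x - q.1)| + Real.log 2 / 2) / (2 * Real.pi)), integral_div,
    integral_add hlog (integrable_const _)]
  have h2 := integral_abs_log_sub_le hq.1
  have h3 := Real.log_two_gt_d9
  have h4 := Real.pi_gt_three
  rw [div_le_iff₀ (by positivity)]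
  simp only [integral_const, probReal_univ, smul_eq_mul, one_mul]
  nlinarith

lemma integral_sq_integral_psi_mul_le {e : ℝ × ℝ → ℝ} (he1 : ∀ p, |e p| ≤ 1) :
    ∫ q, (∫ p, psi (q - p) * e p ∂squareMeasure) ^ 2 ∂squareMeasure ≤ Real.log 2 ^ 2 := by
  have h : ‖∫ q, (∫ p, psi (q - p) * e p ∂squareMeasure) ^ 2 ∂squareMeasure‖ ≤
      Real.log 2 ^ 2 * squareMeasure.real univ := by
    refine norm_integral_le_of_norm_le_const ?_
    filter_upwards [ae_restrict_mem measurableSet_unitSquare] with q hq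
    rw [norm_pow]
    exact pow_le_pow_left₀ (norm_nonneg _) (abs_integral_psi_mul_le hq he1) 2
  simp only [probReal_univ, mul_one] at h
  exact (le_abs_self _).trans h

/-! ### Compactly supported approximations of the sine modes -/

lemma deriv_smoothTransition_eq_zero {x : ℝ} (hx : x < 0 ∨ 1 < x) :
    deriv Real.smoothTransition x = 0 := by
  rcases hx with hx | hx
  · have h : Real.smoothTransition =ᶠ[nhds x] fun _ => 0 := by
      filter_upwards [Iio_mem_nhds hx] with y hy
      exact Real.smoothTransition.zero_of_nonpos (le_of_lt hy)
    simp [h.deriv_eq]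
  · have h : Real.smoothTransition =ᶠ[nhds x] fun _ => 1 := by
      filter_upwards [Ioi_mem_nhds hx] with y hy
      exact Real.smoothTransition.one_of_one_le (le_of_lt hy)
    simp [h.deriv_eq]

lemma deriv_deriv_smoothTransition_eq_zero {x : ℝ} (hx : x < 0 ∨ 1 < x) :
    deriv (deriv Real.smoothTransition) x = 0 := by
  have h : deriv Real.smoothTransition =ᶠ[nhds x] fun _ => 0 := by
    rcases hx with hx | hx
    · filter_upwards [Iio_mem_nhds hx] with y hy
      exact deriv_smoothTransition_eq_zero (Or.inl hy)
    · filter_upwards [Ioi_mem_nhds hx] with y hy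
      exact deriv_smoothTransition_eq_zero (Or.inr hy)
  simp [h.deriv_eq]

lemma exists_abs_le_of_continuous_of_eq_zero {g : ℝ → ℝ} (hg : Continuous g)
    (h0 : ∀ x, x < 0 ∨ 1 < x → g x = 0) : ∃ C, ∀ x, |g x| ≤ C := by
  obtain ⟨C, hC⟩ := isCompact_Icc.exists_bound_of_continuousOn (s := Icc (0 : ℝ) 1) hg.continuousOn
  refine ⟨C, fun x => ?_⟩
  by_cases hx : x ∈ Icc (0 : ℝ) 1
  · exact hC x hx
  · rw [h0 x (by by_contra! h; exact hx ⟨h.1, h.2⟩), abs_zero]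
    exact (norm_nonneg _).trans (hC 0 (by simp))

lemma exists_smoothTransition_deriv_bound : ∃ C, 0 ≤ C ∧ ∀ x,
    |deriv Real.smoothTransition x| ≤ C ∧ |deriv (deriv Real.smoothTransition) x| ≤ C := by
  have h2 : ContDiff ℝ 2 Real.smoothTransition := Real.smoothTransition.contDiff (n := 2)
  have h1 : ContDiff ℝ 1 (deriv Real.smoothTransition) :=
    (contDiff_succ_iff_deriv (n := 1)).1 h2 |>.2.2
  obtain ⟨C, hC⟩ := exists_abs_le_of_continuous_of_eq_zero h1.continuous
    fun x => deriv_smoothTransition_eq_zero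
  obtain ⟨D, hD⟩ := exists_abs_le_of_continuous_of_eq_zero h1.continuous_deriv_one
    fun x => deriv_deriv_smoothTransition_eq_zero
  exact ⟨max C D, (abs_nonneg _).trans ((hC 0).trans (le_max_left _ _)), fun x =>
    ⟨(hC x).trans (le_max_left _ _), (hD x).trans (le_max_right _ _)⟩⟩

/-- A smooth cutoff function on `[0, 1]`: it vanishes at distance at most `1 / k` from the end
points and equals `1` at distance at least `2 / k` from them. -/
noncomputable def edgeCutoff (k : ℕ) (x : ℝ) : ℝ :=
  Real.smoothTransition (k * x - 1) * Real.smoothTransition (k * (1 - x) - 1)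

/-- The compactly supported approximation of `sin (N π x)` obtained from `edgeCutoff`. -/
noncomputable def cutoffSine (N k : ℕ) (x : ℝ) : ℝ :=
  edgeCutoff k x * Real.sin (N * Real.pi * x)

lemma contDiff_edgeCutoff (k : ℕ) {n : ℕ∞} : ContDiff ℝ n (edgeCutoff k) := by
  have h : ContDiff ℝ n Real.smoothTransition := Real.smoothTransition.contDiff
  exact (h.comp (by fun_prop : ContDiff ℝ n fun x : ℝ => (k : ℝ) * x - 1)).mul
    (h.comp (by fun_prop : ContDiff ℝ n fun x : ℝ => (k : ℝ) * (1 - x) - 1))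

lemma contDiff_cutoffSine (N k : ℕ) {n : ℕ∞} : ContDiff ℝ n (cutoffSine N k) :=
  (contDiff_edgeCutoff k).mul (by fun_prop)

lemma abs_edgeCutoff_le_one (k : ℕ) (x : ℝ) : |edgeCutoff k x| ≤ 1 := by
  rw [edgeCutoff, abs_of_nonneg (mul_nonneg (Real.smoothTransition.nonneg _)
    (Real.smoothTransition.nonneg _))]
  exact mul_le_one₀ (Real.smoothTransition.le_one _) (Real.smoothTransition.nonneg _)
    (Real.smoothTransition.le_one _)

lemma abs_cutoffSine_le_one (N k : ℕ) (x : ℝ) : |cutoffSine N k x| ≤ 1 := by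
  rw [cutoffSine, abs_mul]
  exact mul_le_one₀ (abs_edgeCutoff_le_one k x) (abs_nonneg _) (Real.abs_sin_le_one _)

lemma cutoffSine_eq_zero (N : ℕ) {k : ℕ} (hk : 0 < k) {x : ℝ}
    (hx : x ∉ Icc (1 / (k : ℝ)) (1 - 1 / k)) : cutoffSine N k x = 0 := by
  have hk' : (0 : ℝ) < k := Nat.cast_pos.2 hk
  have h : x ≤ 1 / k ∨ 1 - 1 / k ≤ x := by
    by_contra! h
    exact hx ⟨h.1.le, h.2.le⟩
  rw [cutoffSine, edgeCutoff]
  rcases h with h | h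
  · rw [Real.smoothTransition.zero_of_nonpos]
    · simp
    · rw [le_div_iff₀ hk'] at h
      linarith
  · rw [Real.smoothTransition.zero_of_nonpos (x := k * (1 - x) - 1)]
    · simp
    · have : (1 - x) ≤ 1 / k := by linarith
      rw [le_div_iff₀ hk'] at this
      linarith

lemma edgeCutoff_eq_one {k : ℕ} (hk : 0 < k) {x : ℝ}
    (hx : x ∈ Icc (2 / (k : ℝ)) (1 - 2 / k)) : edgeCutoff k x = 1 := by
  have hk' : (0 : ℝ) < k := Nat.cast_pos.2 hk
  have h1 := hx.1
  have h2 : 2 / k ≤ 1 - x := by linarith [hx.2]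
  rw [div_le_iff₀ hk'] at h1 h2
  rw [edgeCutoff, Real.smoothTransition.one_of_one_le (by linarith),
    Real.smoothTransition.one_of_one_le (by linarith), one_mul]

lemma exists_edgeCutoff_deriv_bound : ∃ C, 0 ≤ C ∧ ∀ (k : ℕ) (x : ℝ),
    |deriv (edgeCutoff k) x| ≤ C * k ∧ |deriv (deriv (edgeCutoff k)) x| ≤ C * (k : ℝ) ^ 2 := by
  obtain ⟨C, hC0, hC⟩ := exists_smoothTransition_deriv_bound
  refine ⟨2 * C + 2 * C ^ 2, by positivity, fun k x => ?_⟩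
  have hT2 : ContDiff ℝ 2 Real.smoothTransition := Real.smoothTransition.contDiff (n := 2)
  have hT1 : ContDiff ℝ 1 (deriv Real.smoothTransition) :=
    (contDiff_succ_iff_deriv (n := 1)).1 hT2 |>.2.2
  have hT : ∀ z, HasDerivAt Real.smoothTransition (deriv Real.smoothTransition z) z := fun z =>
    (hT2.differentiable (by norm_num) z).hasDerivAt
  have hT' : ∀ z, HasDerivAt (deriv Real.smoothTransition)
      (deriv (deriv Real.smoothTransition) z) z := fun z =>
    (hT1.differentiable (by norm_num) z).hasDerivAt
  have hl : ∀ x : ℝ, HasDerivAt (fun x : ℝ => (k : ℝ) * x - 1) k x := fun x => by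
    simpa using ((hasDerivAt_id x).const_mul (k : ℝ)).sub_const 1
  have hr : ∀ x : ℝ, HasDerivAt (fun x : ℝ => (k : ℝ) * (1 - x) - 1) (-k) x := fun x => by
    simpa using (((hasDerivAt_id x).const_sub 1).const_mul (k : ℝ)).sub_const 1
  have hA := fun x => (hT _).comp x (hl x)
  have hB := fun x => (hT _).comp x (hr x)
  have hA' := fun x => ((hT' _).comp x (hl x)).mul_const (k : ℝ)
  have hB' := fun x => ((hT' _).comp x (hr x)).mul_const (-k : ℝ)
  have hd : deriv (edgeCutoff k) = _ := funext fun x => ((hA x).mul (hB x)).deriv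
  have hdd := ((((hA' x).mul (hB x)).add ((hA x).mul (hB' x))).congr_of_eventuallyEq
    (Filter.EventuallyEq.of_eq hd)).deriv
  rw [hdd, hd]
  simp only [Function.comp_apply]
  set a := Real.smoothTransition (k * x - 1)
  set b := Real.smoothTransition (k * (1 - x) - 1)
  have ha : |a| ≤ 1 := abs_le.2
    ⟨by linarith [Real.smoothTransition.nonneg (k * x - 1)], Real.smoothTransition.le_one _⟩
  have hb : |b| ≤ 1 := abs_le.2
    ⟨by linarith [Real.smoothTransition.nonneg (k * (1 - x) - 1)], Real.smoothTransition.le_one _⟩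
  obtain ⟨ha1, ha2⟩ := hC (k * x - 1)
  obtain ⟨hb1, hb2⟩ := hC (k * (1 - x) - 1)
  set a1 := deriv Real.smoothTransition (k * x - 1)
  set b1 := deriv Real.smoothTransition (k * (1 - x) - 1)
  set a2 := deriv (deriv Real.smoothTransition) (k * x - 1)
  set b2 := deriv (deriv Real.smoothTransition) (k * (1 - x) - 1)
  have hk : (0 : ℝ) ≤ k := Nat.cast_nonneg k
  have key : ∀ {s t S T : ℝ}, |s| ≤ S → |t| ≤ T → 0 ≤ S → |s * t| ≤ S * T := fun h1 h2 h3 => by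
    rw [abs_mul]
    exact mul_le_mul h1 h2 (abs_nonneg _) h3
  have e1 := abs_le.1 (key ha1 hb hC0)
  have e2 := abs_le.1 (key ha hb1 zero_le_one)
  have e3 := abs_le.1 (key ha2 hb hC0)
  have e4 := abs_le.1 (key ha hb2 zero_le_one)
  have e5 := abs_le.1 (key ha1 hb1 hC0)
  constructor
  · have : a1 * ↑k * b + a * (b1 * -↑k) = (a1 * b - a * b1) * k := by ring
    rw [this, abs_mul, abs_of_nonneg hk]
    gcongr
    exact abs_le.2 ⟨by nlinarith, by nlinarith⟩
  · have : a2 * ↑k * ↑k * b + a1 * ↑k * (b1 * -↑k) + (a1 * ↑k * (b1 * -↑k) + a * (b2 * -↑k * -↑k))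
        = (a2 * b - 2 * (a1 * b1) + a * b2) * (k : ℝ) ^ 2 := by ring
    rw [this, abs_mul, abs_of_nonneg (sq_nonneg (k : ℝ))]
    gcongr
    exact abs_le.2 ⟨by nlinarith, by nlinarith⟩

lemma abs_sin_nat_mul_pi_le (N : ℕ) {x : ℝ} (hx : x ∈ Icc (0 : ℝ) 1) :
    |Real.sin (N * Real.pi * x)| ≤ N * Real.pi * x ∧
      |Real.sin (N * Real.pi * x)| ≤ N * Real.pi * (1 - x) := by
  have hpos : 0 ≤ N * Real.pi := by positivity
  constructor
  · exact (Real.abs_sin_le_abs).trans_eq (abs_of_nonneg (mul_nonneg hpos hx.1))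
  · have h : |Real.sin (N * Real.pi * x)| = |Real.sin (N * Real.pi * (1 - x))| := by
      rw [mul_sub, mul_one, Real.sin_nat_mul_pi_sub, abs_neg, abs_mul]
      simp
    rw [h]
    exact (Real.abs_sin_le_abs).trans_eq
      (abs_of_nonneg (mul_nonneg hpos (sub_nonneg.2 hx.2)))

lemma hasDerivAt_sin_cos_nat_mul_pi (N : ℕ) (x : ℝ) :
    HasDerivAt (fun x => Real.sin (N * Real.pi * x))
      (Real.cos (N * Real.pi * x) * (N * Real.pi)) x ∧
    HasDerivAt (fun x => Real.cos (N * Real.pi * x) * (N * Real.pi))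
      (-((N * Real.pi) ^ 2 * Real.sin (N * Real.pi * x))) x := by
  have hl : HasDerivAt (fun x : ℝ => N * Real.pi * x) (N * Real.pi) x := by
    simpa using (hasDerivAt_id x).const_mul (N * Real.pi)
  refine ⟨hl.sin, ?_⟩
  convert! hl.cos.mul_const (N * Real.pi) using 1
  ring

lemma deriv_deriv_cutoffSine (N k : ℕ) (x : ℝ) :
    deriv (deriv (cutoffSine N k)) x =
      deriv (deriv (edgeCutoff k)) x * Real.sin (N * Real.pi * x) +
      2 * (deriv (edgeCutoff k) x * (Real.cos (N * Real.pi * x) * (N * Real.pi))) -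
      edgeCutoff k x * ((N * Real.pi) ^ 2 * Real.sin (N * Real.pi * x)) := by
  have hc2 : ContDiff ℝ 2 (edgeCutoff k) := contDiff_edgeCutoff k (n := 2)
  have hc1 : ContDiff ℝ 1 (deriv (edgeCutoff k)) :=
    (contDiff_succ_iff_deriv (n := 1)).1 hc2 |>.2.2
  have h1 : ∀ x, HasDerivAt (edgeCutoff k) (deriv (edgeCutoff k) x) x := fun z =>
    (hc2.differentiable (by norm_num) z).hasDerivAt
  have h2 : ∀ x, HasDerivAt (deriv (edgeCutoff k)) (deriv (deriv (edgeCutoff k)) x) x := fun z =>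
    (hc1.differentiable (by norm_num) z).hasDerivAt
  have hs := fun x => (hasDerivAt_sin_cos_nat_mul_pi N x).1
  have hs' := fun x => (hasDerivAt_sin_cos_nat_mul_pi N x).2
  have hd : deriv (cutoffSine N k) = _ := funext fun x => ((h1 x).mul (hs x)).deriv
  rw [((((h2 x).mul (hs x)).add ((h1 x).mul (hs' x))).congr_of_eventuallyEq
    (Filter.EventuallyEq.of_eq hd)).deriv]
  ring

lemma deriv_edgeCutoff_eq_zero {k : ℕ} (hk : 0 < k) {x : ℝ}
    (hx : x ∈ Ioo (2 / (k : ℝ)) (1 - 2 / k)) :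
    deriv (edgeCutoff k) x = 0 ∧ deriv (deriv (edgeCutoff k)) x = 0 := by
  have h1 : ∀ y ∈ Ioo (2 / (k : ℝ)) (1 - 2 / k), deriv (edgeCutoff k) y = 0 := by
    intro y hy
    have h : edgeCutoff k =ᶠ[nhds y] fun _ => 1 := by
      filter_upwards [Ioo_mem_nhds hy.1 hy.2] with z hz
      exact edgeCutoff_eq_one hk (Ioo_subset_Icc_self hz)
    simp [h.deriv_eq]
  refine ⟨h1 x hx, ?_⟩
  have h : deriv (edgeCutoff k) =ᶠ[nhds x] fun _ => 0 := by
    filter_upwards [Ioo_mem_nhds hx.1 hx.2] with z hz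
    exact h1 z hz
  simp [h.deriv_eq]

/-- The second derivative of `cutoffSine` differs from that of `sin (N π x)` only within distance
`2 / k` of the end points. -/
lemma deriv_deriv_cutoffSine_eq (N : ℕ) {k : ℕ} (hk : 0 < k) {x : ℝ}
    (hx : x ∈ Ioo (2 / (k : ℝ)) (1 - 2 / k)) :
    deriv (deriv (cutoffSine N k)) x = -((N * Real.pi) ^ 2 * Real.sin (N * Real.pi * x)) := by
  rw [deriv_deriv_cutoffSine, (deriv_edgeCutoff_eq_zero hk hx).1, (deriv_edgeCutoff_eq_zero hk hx).2,
    edgeCutoff_eq_one hk (Ioo_subset_Icc_self hx)]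
  ring

/-- The second derivative of `cutoffSine` is of order `k` only, although that of the cutoff
function is of order `k²`: the sine is of order `1 / k` where the cutoff is not constant. -/
lemma exists_cutoffSine_deriv_deriv_bound (N : ℕ) : ∃ C, 0 ≤ C ∧ ∀ k : ℕ, 0 < k →
    ∀ x ∈ Icc (0 : ℝ) 1, |deriv (deriv (cutoffSine N k)) x +
      (N * Real.pi) ^ 2 * Real.sin (N * Real.pi * x)| ≤ C * k := by
  obtain ⟨C, hC0, hC⟩ := exists_edgeCutoff_deriv_bound
  have hN : 0 ≤ N * Real.pi := by positivity
  refine ⟨C * (N * Real.pi * 2) + 2 * (C * (N * Real.pi)) + 2 * (N * Real.pi) ^ 2, by positivity,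
    fun k hk x hx => ?_⟩
  have hk' : (0 : ℝ) < k := Nat.cast_pos.2 hk
  by_cases hmid : x ∈ Ioo (2 / (k : ℝ)) (1 - 2 / k)
  · rw [deriv_deriv_cutoffSine_eq N hk hmid, neg_add_cancel, abs_zero]
    positivity
  have hs : |Real.sin (N * Real.pi * x)| ≤ N * Real.pi * (2 / k) := by
    obtain ⟨h1, h2⟩ := abs_sin_nat_mul_pi_le N hx
    by_cases h3 : x ≤ 2 / k
    · exact h1.trans (by gcongr)
    · have h4 : 1 - 2 / (k : ℝ) ≤ x := by
        by_contra! h4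
        exact hmid ⟨not_le.1 h3, h4⟩
      exact h2.trans (by gcongr; linarith)
  have e1 : |deriv (deriv (edgeCutoff k)) x * Real.sin (N * Real.pi * x)| ≤
      C * (N * Real.pi * 2) * k := by
    rw [abs_mul]
    calc _ ≤ C * (k : ℝ) ^ 2 * (N * Real.pi * (2 / k)) :=
          mul_le_mul (hC k x).2 hs (abs_nonneg _) (by positivity)
      _ = C * (N * Real.pi * 2) * k := by field_simp
  have e2 : |deriv (edgeCutoff k) x * (Real.cos (N * Real.pi * x) * (N * Real.pi))| ≤
      C * (N * Real.pi) * k := by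
    rw [abs_mul, abs_mul, abs_of_nonneg hN]
    calc _ ≤ C * k * (1 * (N * Real.pi)) := by
          gcongr
          exacts [(hC k x).1, Real.abs_cos_le_one _]
      _ = C * (N * Real.pi) * k := by ring
  have e3 : |(1 - edgeCutoff k x) * ((N * Real.pi) ^ 2 * Real.sin (N * Real.pi * x))| ≤
      2 * (N * Real.pi) ^ 2 * k := by
    rw [abs_mul, abs_mul, abs_of_nonneg (sq_nonneg (N * Real.pi))]
    have h1 : |1 - edgeCutoff k x| ≤ 2 := by
      have := abs_le.1 (abs_edgeCutoff_le_one k x)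
      exact abs_le.2 ⟨by linarith, by linarith⟩
    have hk1 : (1 : ℝ) ≤ k := Nat.one_le_cast.2 hk
    calc _ ≤ 2 * ((N * Real.pi) ^ 2 * 1) := by
          gcongr
          exact Real.abs_sin_le_one _
      _ = 2 * (N * Real.pi) ^ 2 * 1 := by ring
      _ ≤ _ := by gcongr
  rw [deriv_deriv_cutoffSine]
  rw [abs_le] at e1 e2 e3 ⊢
  constructor <;> nlinarith

lemma tendsto_cutoffSine (N : ℕ) {x : ℝ} (hx : x ∈ Icc (0 : ℝ) 1) :
    Filter.Tendsto (fun k => cutoffSine N k x) Filter.atTop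
      (nhds (Real.sin (N * Real.pi * x))) := by
  by_cases h : Real.sin (N * Real.pi * x) = 0
  · simp [cutoffSine, h]
  have h0 : x ≠ 0 := by
    rintro rfl
    simp at h
  have h1 : x ≠ 1 := by
    rintro rfl
    simp at h
  have hx0 : 0 < x := lt_of_le_of_ne hx.1 h0.symm
  have hx1 : 0 < 1 - x := sub_pos.2 (lt_of_le_of_ne hx.2 h1)
  have hlim := tendsto_const_div_atTop_nhds_zero_nat (2 : ℝ)
  refine tendsto_const_nhds.congr' ?_
  filter_upwards [hlim.eventually_le_const hx0, hlim.eventually_le_const hx1,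
    Filter.eventually_gt_atTop 0] with k hk1 hk2 hk
  rw [cutoffSine, edgeCutoff_eq_one hk ⟨hk1, by linarith⟩, one_mul]

/-- The compactly supported approximation of the eigenfunction `sineMode n m`. -/
noncomputable def cutoffMode (n m k : ℕ) (p : ℝ × ℝ) : ℝ :=
  cutoffSine n k p.1 * cutoffSine m k p.2

lemma contDiff_cutoffMode (n m k : ℕ) {r : ℕ∞} : ContDiff ℝ r (cutoffMode n m k) :=
  ((contDiff_cutoffSine n k).comp contDiff_fst).mul ((contDiff_cutoffSine m k).comp contDiff_snd)

lemma continuous_cutoffSine (N k : ℕ) : Continuous (cutoffSine N k) :=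
  (contDiff_cutoffSine N k (n := 0)).continuous

lemma continuous_cutoffMode (n m k : ℕ) : Continuous (cutoffMode n m k) :=
  (contDiff_cutoffMode n m k (r := 0)).continuous

lemma interior_unitSquare : interior unitSquare = Ioo 0 1 ×ˢ Ioo 0 1 := by
  rw [unitSquare, interior_prod_eq, interior_Icc]

lemma isCompact_unitSquare : IsCompact unitSquare := isCompact_Icc.prod isCompact_Icc

lemma frontier_unitSquare : frontier unitSquare = unitSquare \ Ioo 0 1 ×ˢ Ioo 0 1 := by
  rw [frontier, isCompact_unitSquare.isClosed.closure_eq, interior_unitSquare]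

lemma tsupport_cutoffMode_subset (n m : ℕ) {k : ℕ} (hk : 0 < k) :
    tsupport (cutoffMode n m k) ⊆
      Icc (1 / (k : ℝ)) (1 - 1 / k) ×ˢ Icc (1 / (k : ℝ)) (1 - 1 / k) := by
  refine closure_minimal (fun p hp => ?_) (isClosed_Icc.prod isClosed_Icc)
  by_contra h
  refine hp ?_
  rw [mem_prod, not_and_or] at h
  rw [cutoffMode]
  rcases h with h | h
  · rw [cutoffSine_eq_zero n hk h, zero_mul]
  · rw [cutoffSine_eq_zero m hk h, mul_zero]

lemma hasCompactSupport_cutoffMode (n m : ℕ) {k : ℕ} (hk : 0 < k) :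
    HasCompactSupport (cutoffMode n m k) :=
  (isCompact_Icc.prod isCompact_Icc).of_isClosed_subset (isClosed_tsupport _)
    (tsupport_cutoffMode_subset n m hk)

lemma tsupport_cutoffMode_subset_interior (n m : ℕ) {k : ℕ} (hk : 0 < k) :
    tsupport (cutoffMode n m k) ⊆ interior unitSquare := by
  have hk' : (0 : ℝ) < 1 / k := by positivity
  have h : Icc (1 / (k : ℝ)) (1 - 1 / k) ⊆ Ioo 0 1 := fun x hx =>
    ⟨hk'.trans_le hx.1, by linarith [hx.2]⟩
  rw [interior_unitSquare]
  exact (tsupport_cutoffMode_subset n m hk).trans (prod_mono h h)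

lemma planeLaplacian_cutoffMode (n m k : ℕ) (p : ℝ × ℝ) :
    planeLaplacian (cutoffMode n m k) p =
      deriv (deriv (cutoffSine n k)) p.1 * cutoffSine m k p.2 +
        cutoffSine n k p.1 * deriv (deriv (cutoffSine m k)) p.2 := by
  simp only [planeLaplacian, cutoffMode, iteratedDeriv_succ, iteratedDeriv_zero]
  simp

lemma abs_sineMode_le_one (n m : ℕ) (p : ℝ × ℝ) : |sineMode n m p| ≤ 1 := by
  rw [sineMode, abs_mul]
  exact mul_le_one₀ (Real.abs_sin_le_one _) (abs_nonneg _) (Real.abs_sin_le_one _)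

lemma continuous_sineMode (n m : ℕ) : Continuous (sineMode n m) := by
  unfold sineMode
  fun_prop

lemma abs_cutoffMode_le_one (n m k : ℕ) (p : ℝ × ℝ) : |cutoffMode n m k p| ≤ 1 := by
  rw [cutoffMode, abs_mul]
  exact mul_le_one₀ (abs_cutoffSine_le_one n k _) (abs_nonneg _) (abs_cutoffSine_le_one m k _)

lemma tendsto_cutoffMode (n m : ℕ) {p : ℝ × ℝ} (hp : p ∈ unitSquare) :
    Filter.Tendsto (fun k => cutoffMode n m k p) Filter.atTop (nhds (sineMode n m p)) :=
  (tendsto_cutoffSine n hp.1).mul (tendsto_cutoffSine m hp.2)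

lemma continuous_deriv_deriv_cutoffSine (N k : ℕ) :
    Continuous (deriv (deriv (cutoffSine N k))) := by
  have h2 : ContDiff ℝ 2 (cutoffSine N k) := contDiff_cutoffSine N k (n := 2)
  have h1 : ContDiff ℝ 1 (deriv (cutoffSine N k)) :=
    (contDiff_succ_iff_deriv (n := 1)).1 h2 |>.2.2
  exact h1.continuous_deriv_one

lemma memLp_two_of_continuous {g : ℝ × ℝ → ℝ} (hg : Continuous g) (h1 : ∀ p, |g p| ≤ 1) :
    MemLp g 2 squareMeasure :=
  MemLp.of_bound hg.aestronglyMeasurable 1 (Filter.Eventually.of_forall h1)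

/-! ### Passing to the limit against functions vanishing on the boundary -/

lemma exists_abs_le_near_edges {v : ℝ × ℝ → ℝ} (hv : ContinuousOn v unitSquare)
    (hv0 : ∀ p ∈ frontier unitSquare, v p = 0) {ε : ℝ} (hε : 0 < ε) :
    ∃ δ > 0, ∀ p ∈ unitSquare, p.1 ≤ δ ∨ 1 - δ ≤ p.1 → |v p| ≤ ε := by
  have huc := isCompact_unitSquare.uniformContinuousOn_of_continuous hv
  obtain ⟨δ, hδ, h⟩ := Metric.uniformContinuousOn_iff.1 huc ε hε
  refine ⟨δ / 2, half_pos hδ, fun p hp hpe => ?_⟩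
  have hfr : ∀ x : ℝ, x = 0 ∨ x = 1 → (x, p.2) ∈ unitSquare ∧ (x, p.2) ∈ frontier unitSquare := by
    intro x hx
    have hx1 : x ∈ Icc (0 : ℝ) 1 := by
      rcases hx with rfl | rfl <;> simp
    have hx2 : x ∉ Ioo (0 : ℝ) 1 := by
      rcases hx with rfl | rfl <;> simp
    have hmem : (x, p.2) ∈ unitSquare := ⟨hx1, hp.2⟩
    rw [frontier_unitSquare]
    exact ⟨hmem, hmem, fun h => hx2 h.1⟩
  have key : ∀ x : ℝ, x = 0 ∨ x = 1 → |p.1 - x| < δ → |v p| ≤ ε := by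
    intro x hx hd
    have h1 := h p hp (x, p.2) (hfr x hx).1 (by
      rw [Prod.dist_eq]
      simpa [Real.dist_eq, hδ] using hd)
    rw [hv0 _ (hfr x hx).2, dist_zero_right] at h1
    exact h1.le
  rcases hpe with h1 | h1
  · refine key 0 (Or.inl rfl) ?_
    rw [sub_zero, abs_of_nonneg hp.1.1]
    linarith
  · refine key 1 (Or.inr rfl) ?_
    rw [abs_sub_comm, abs_of_nonneg (sub_nonneg.2 hp.1.2)]
    linarith

lemma integrable_squareMeasure_of_continuousOn {v : ℝ × ℝ → ℝ} (hv : ContinuousOn v unitSquare) :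
    Integrable v squareMeasure :=
  hv.integrableOn_compact isCompact_unitSquare

/-- The contribution of the boundary layer: there the defect of the second derivative is of order
`k`, the layer has width `2 / k`, and `v` is uniformly small. -/
lemma tendsto_integral_mul_cutoff_defect {v : ℝ × ℝ → ℝ} (hv : ContinuousOn v unitSquare)
    (hv0 : ∀ p ∈ frontier unitSquare, v p = 0) (n m : ℕ) :
    Filter.Tendsto (fun k => ∫ p, v p * ((deriv (deriv (cutoffSine n k)) p.1 +
        (n * Real.pi) ^ 2 * Real.sin (n * Real.pi * p.1)) * cutoffSine m k p.2) ∂squareMeasure)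
      Filter.atTop (nhds 0) := by
  obtain ⟨C, hC0, hC⟩ := exists_cutoffSine_deriv_deriv_bound n
  rw [NormedAddGroup.tendsto_nhds_zero]
  intro ε hε
  set ε' := ε / (4 * C + 1) with hε'
  have hε'0 : 0 < ε' := by positivity
  have hε'1 : 4 * C * ε' < ε := by
    rw [hε', mul_div_assoc', div_lt_iff₀ (by positivity)]
    nlinarith
  obtain ⟨δ, hδ, hsmall⟩ := exists_abs_le_near_edges hv hv0 hε'0
  have hlim := tendsto_const_div_atTop_nhds_zero_nat (2 : ℝ)
  filter_upwards [hlim.eventually_le_const hδ, Filter.eventually_gt_atTop 0] with k hk1 hk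
  have hk' : (0 : ℝ) < k := Nat.cast_pos.2 hk
  set a : ℝ := 2 / k with ha
  have ha0 : 0 < a := by positivity
  set g : ℝ → ℝ := fun x => ε' * (C * k) *
    ((Iic a).indicator 1 x + (Ici (1 - a)).indicator 1 x) with hg
  have hi1 : Integrable ((Iic a).indicator (1 : ℝ → ℝ)) (volume.restrict (Icc (0 : ℝ) 1)) :=
    (integrable_const (1 : ℝ)).indicator measurableSet_Iic
  have hi2 : Integrable ((Ici (1 - a)).indicator (1 : ℝ → ℝ)) (volume.restrict (Icc (0 : ℝ) 1)) :=
    (integrable_const (1 : ℝ)).indicator measurableSet_Ici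
  have hgi : Integrable g (volume.restrict (Icc (0 : ℝ) 1)) := (hi1.add hi2).const_mul _
  have hgi2 : Integrable (fun p : ℝ × ℝ => g p.1) squareMeasure := by
    rw [squareMeasure_eq_prod]
    exact hgi.comp_fst _
  have hgint : ∫ x in Icc (0 : ℝ) 1, g x ≤ 4 * C * ε' := by
    simp only [hg]
    rw [integral_const_mul, integral_add hi1 hi2, integral_indicator_one measurableSet_Iic,
      integral_indicator_one measurableSet_Ici]
    have h1 : (volume.restrict (Icc (0 : ℝ) 1)).real (Iic a) ≤ a := by
      rw [measureReal_restrict_apply measurableSet_Iic]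
      have hsub : Iic a ∩ Icc 0 1 ⊆ Icc 0 a := fun x hx => ⟨hx.2.1, hx.1⟩
      refine (measureReal_mono hsub measure_Icc_lt_top.ne).trans ?_
      simp [ha0.le]
    have h2 : (volume.restrict (Icc (0 : ℝ) 1)).real (Ici (1 - a)) ≤ a := by
      rw [measureReal_restrict_apply measurableSet_Ici]
      have hsub : Ici (1 - a) ∩ Icc 0 1 ⊆ Icc (1 - a) 1 := fun x hx => ⟨hx.1, hx.2.2⟩
      refine (measureReal_mono hsub measure_Icc_lt_top.ne).trans ?_
      simp [ha0.le]
    calc _ ≤ ε' * (C * k) * (a + a) := by gcongr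
      _ = 4 * C * ε' := by rw [ha]; field_simp; ring
  refine lt_of_le_of_lt ?_ (hgint.trans_lt hε'1)
  rw [← integral_squareMeasure_fst]
  refine norm_integral_le_of_norm_le hgi2 ?_
  filter_upwards [ae_restrict_mem measurableSet_unitSquare] with p hp
  rw [norm_mul, norm_mul]
  by_cases hmid : p.1 ∈ Ioo a (1 - a)
  · rw [deriv_deriv_cutoffSine_eq n hk hmid, neg_add_cancel, norm_zero, zero_mul, mul_zero]
    refine mul_nonneg (by positivity) (add_nonneg ?_ ?_) <;>
      exact indicator_nonneg (fun _ _ => zero_le_one) _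
  have hedge : p.1 ≤ a ∨ 1 - a ≤ p.1 := by
    by_contra! h
    exact hmid h
  have hone : 1 ≤ (Iic a).indicator (1 : ℝ → ℝ) p.1 + (Ici (1 - a)).indicator 1 p.1 := by
    rcases hedge with h | h
    · rw [indicator_of_mem (show p.1 ∈ Iic a from h), Pi.one_apply]
      exact le_add_of_nonneg_right (indicator_nonneg (fun _ _ => zero_le_one) _)
    · rw [indicator_of_mem (show p.1 ∈ Ici (1 - a) from h), Pi.one_apply]
      exact le_add_of_nonneg_left (indicator_nonneg (fun _ _ => zero_le_one) _)
  have hv1 : ‖v p‖ ≤ ε' := hsmall p hp (hedge.imp (fun h => h.trans hk1) fun h => by linarith)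
  calc _ ≤ ε' * (C * k * 1) := by
        gcongr
        exacts [hC k hk _ hp.1, abs_cutoffSine_le_one m k _]
    _ = ε' * (C * k) * 1 := by ring
    _ ≤ _ := by
        simp only [hg]
        gcongr

lemma tendsto_integral_mul_deriv_deriv_cutoff {v : ℝ × ℝ → ℝ} (hv : ContinuousOn v unitSquare)
    (hv0 : ∀ p ∈ frontier unitSquare, v p = 0) (n m : ℕ) :
    Filter.Tendsto (fun k => ∫ p, v p * (deriv (deriv (cutoffSine n k)) p.1 *
        cutoffSine m k p.2) ∂squareMeasure)
      Filter.atTop (nhds (-((n * Real.pi) ^ 2 * ∫ p, v p * sineMode n m p ∂squareMeasure))) := by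
  have hvi := integrable_squareMeasure_of_continuousOn hv
  have hmain : Filter.Tendsto (fun k => ∫ p, v p * (Real.sin (n * Real.pi * p.1) *
      cutoffSine m k p.2) ∂squareMeasure) Filter.atTop
      (nhds (∫ p, v p * sineMode n m p ∂squareMeasure)) := by
    refine tendsto_integral_of_dominated_convergence (fun p => ‖v p‖) (fun k => ?_) hvi.norm
      (fun k => ?_) ?_
    · have hc := continuous_cutoffSine m k
      exact hvi.1.mul (by fun_prop : Continuous fun p : ℝ × ℝ =>
        Real.sin (n * Real.pi * p.1) * cutoffSine m k p.2).aestronglyMeasurable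
    · refine Filter.Eventually.of_forall fun p => ?_
      rw [norm_mul, norm_mul]
      refine mul_le_of_le_one_right (norm_nonneg _) ?_
      exact mul_le_one₀ (Real.abs_sin_le_one _) (norm_nonneg _) (abs_cutoffSine_le_one m k _)
    · filter_upwards [ae_restrict_mem measurableSet_unitSquare] with p hp
      exact ((tendsto_cutoffSine m hp.2).const_mul _).const_mul _
  have h := (tendsto_integral_mul_cutoff_defect hv hv0 n m).sub (hmain.const_mul ((n * Real.pi) ^ 2))
  rw [zero_sub] at h
  refine h.congr fun k => ?_
  have hc := continuous_cutoffSine m k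
  have hd := continuous_deriv_deriv_cutoffSine n k
  rw [← integral_const_mul, ← integral_sub]
  · refine integral_congr_ae (Filter.Eventually.of_forall fun p => ?_)
    simp only
    ring
  · exact integrable_squareMeasure_of_continuousOn (hv.mul (by fun_prop))
  · exact integrable_squareMeasure_of_continuousOn (continuousOn_const.mul (hv.mul (by fun_prop)))

lemma integral_squareMeasure_swap (g : ℝ × ℝ → ℝ) :
    ∫ p, g p.swap ∂squareMeasure = ∫ p, g p ∂squareMeasure := by
  rw [squareMeasure_eq_prod]
  exact integral_prod_swap g

/-- For `v` continuous on the closed square and zero on its boundary, testing against the Laplacian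
of the cut-off modes amounts in the limit to testing against the Laplacian of the mode itself. No
derivative of `v` is needed. -/
lemma tendsto_integral_mul_planeLaplacian_cutoffMode {v : ℝ × ℝ → ℝ}
    (hv : ContinuousOn v unitSquare) (hv0 : ∀ p ∈ frontier unitSquare, v p = 0) (n m : ℕ) :
    Filter.Tendsto (fun k => ∫ p, v p * planeLaplacian (cutoffMode n m k) p ∂squareMeasure)
      Filter.atTop (nhds (-(Real.pi ^ 2 * ((n : ℝ) ^ 2 + (m : ℝ) ^ 2) *
        ∫ p, v p * sineMode n m p ∂squareMeasure))) := by
  have hswap : MapsTo Prod.swap unitSquare unitSquare := fun p hp => ⟨hp.2, hp.1⟩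
  have hw : ContinuousOn (fun p => v p.swap) unitSquare :=
    hv.comp continuous_swap.continuousOn hswap
  have hw0 : ∀ p ∈ frontier unitSquare, v p.swap = 0 := fun p hp => by
    refine hv0 _ ?_
    rw [frontier_unitSquare] at hp ⊢
    exact ⟨hswap hp.1, fun h => hp.2 ⟨h.2, h.1⟩⟩
  have h1 := tendsto_integral_mul_deriv_deriv_cutoff hv hv0 n m
  have h2 := tendsto_integral_mul_deriv_deriv_cutoff hw hw0 m n
  have h3 : ∫ p, v p.swap * sineMode m n p ∂squareMeasure =
      ∫ p, v p * sineMode n m p ∂squareMeasure := by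
    rw [← integral_squareMeasure_swap (fun p => v p * sineMode n m p)]
    refine integral_congr_ae (Filter.Eventually.of_forall fun p => ?_)
    simp only [sineMode, Prod.fst_swap, Prod.snd_swap]
    ring
  rw [h3] at h2
  have h := h1.add h2
  have hval : -((n * Real.pi) ^ 2 * ∫ p, v p * sineMode n m p ∂squareMeasure) +
      -((m * Real.pi) ^ 2 * ∫ p, v p * sineMode n m p ∂squareMeasure) =
      -(Real.pi ^ 2 * ((n : ℝ) ^ 2 + (m : ℝ) ^ 2) *
        ∫ p, v p * sineMode n m p ∂squareMeasure) := by ring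
  rw [hval] at h
  refine h.congr fun k => ?_
  have hn := continuous_cutoffSine n k
  have hm := continuous_cutoffSine m k
  have hnd := continuous_deriv_deriv_cutoffSine n k
  have hmd := continuous_deriv_deriv_cutoffSine m k
  have h4 : ∫ p, v p.swap * (deriv (deriv (cutoffSine m k)) p.1 * cutoffSine n k p.2)
      ∂squareMeasure = ∫ p, v p * (cutoffSine n k p.1 * deriv (deriv (cutoffSine m k)) p.2)
      ∂squareMeasure := by
    rw [← integral_squareMeasure_swap
      (fun p => v p * (cutoffSine n k p.1 * deriv (deriv (cutoffSine m k)) p.2))]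
    refine integral_congr_ae (Filter.Eventually.of_forall fun p => ?_)
    simp only [Prod.fst_swap, Prod.snd_swap]
    ring
  rw [h4, ← integral_add]
  · refine integral_congr_ae (Filter.Eventually.of_forall fun p => ?_)
    simp only [planeLaplacian_cutoffMode]
    ring
  · exact integrable_squareMeasure_of_continuousOn (hv.mul (by fun_prop))
  · exact integrable_squareMeasure_of_continuousOn (hv.mul (by fun_prop))

/-! ### Green's formula for classical solutions -/

/-- Integration by parts twice, in the form of the fundamental theorem of calculus for the Wronskian
`g φ' - g' φ`, which vanishes near the end points. -/
lemma integral_mul_deriv_deriv_cutoffSine {g : ℝ → ℝ} (hg : ContinuousOn g (Icc 0 1))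
    (hg2 : ContDiffOn ℝ 2 g (Ioo 0 1)) (N : ℕ) {k : ℕ} (hk : 0 < k) :
    ∫ x in Icc (0 : ℝ) 1, g x * deriv (deriv (cutoffSine N k)) x =
      ∫ x in Icc (0 : ℝ) 1, deriv (deriv g) x * cutoffSine N k x := by
  set φ := cutoffSine N k with hφ
  have hφ2 : ContDiff ℝ 2 φ := contDiff_cutoffSine N k (n := 2)
  have hφ1 : ContDiff ℝ 1 (deriv φ) := (contDiff_succ_iff_deriv (n := 1)).1 hφ2 |>.2.2
  have hdφ : ∀ x, HasDerivAt φ (deriv φ x) x := fun x =>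
    (hφ2.differentiable (by norm_num) x).hasDerivAt
  have hddφ : ∀ x, HasDerivAt (deriv φ) (deriv (deriv φ) x) x := fun x =>
    (hφ1.differentiable (by norm_num) x).hasDerivAt
  obtain ⟨hgd, -, hg1⟩ := (contDiffOn_succ_iff_deriv_of_isOpen (n := 1) isOpen_Ioo).1 hg2
  obtain ⟨hgdd, -, hg0⟩ := (contDiffOn_succ_iff_deriv_of_isOpen (n := 0) isOpen_Ioo).1 hg1
  have hk' : (0 : ℝ) < 1 / k := by positivity
  -- `φ` vanishes in a neighbourhood of every point outside the open interval
  have hnear : ∀ x ∉ Ioo (0 : ℝ) 1, φ =ᶠ[nhds x] fun _ => 0 := by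
    intro x hx
    have hx' : x ∈ (Icc (1 / (k : ℝ)) (1 - 1 / k))ᶜ := fun h =>
      hx ⟨hk'.trans_le h.1, by linarith [h.2]⟩
    filter_upwards [isClosed_Icc.isOpen_compl.mem_nhds hx'] with y hy
    exact cutoffSine_eq_zero N hk hy
  have hnear' : ∀ x ∉ Ioo (0 : ℝ) 1, deriv φ =ᶠ[nhds x] fun _ => 0 := fun x hx => by
    simpa using (hnear x hx).deriv
  have hprod : ContinuousOn (fun x => deriv (deriv g) x * φ x) (Icc 0 1) := by
    intro x _
    by_cases hx : x ∈ Ioo (0 : ℝ) 1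
    · exact ((hg0.continuousOn.continuousAt (isOpen_Ioo.mem_nhds hx)).mul
        (hdφ x).continuousAt).continuousWithinAt
    · have h0 : (fun x => deriv (deriv g) x * φ x) =ᶠ[nhds x] fun _ => 0 := by
        filter_upwards [hnear x hx] with y hy
        rw [hy, mul_zero]
      exact (continuousAt_const.congr h0.symm).continuousWithinAt
  have hprod' : ContinuousOn (fun x => g x * deriv (deriv φ) x) (Icc 0 1) :=
    hg.mul hφ1.continuous_deriv_one.continuousOn
  have hderiv : ∀ x, HasDerivAt (fun x => g x * deriv φ x - deriv g x * φ x)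
      (g x * deriv (deriv φ) x - deriv (deriv g) x * φ x) x := by
    intro x
    by_cases hx : x ∈ Ioo (0 : ℝ) 1
    · have h1 := (hgd.differentiableAt (isOpen_Ioo.mem_nhds hx)).hasDerivAt
      have h2 := (hgdd.differentiableAt (isOpen_Ioo.mem_nhds hx)).hasDerivAt
      convert! (h1.mul (hddφ x)).sub (h2.mul (hdφ x)) using 1
      ring
    · have h0 : (fun x => g x * deriv φ x - deriv g x * φ x) =ᶠ[nhds x] fun _ => 0 := by
        filter_upwards [hnear x hx, hnear' x hx] with y hy hy'
        rw [hy, hy', mul_zero, mul_zero, sub_zero]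
      have h1 : deriv (deriv φ) x = 0 := by simp [(hnear' x hx).deriv_eq]
      rw [h1, (hnear x hx).eq_of_nhds, mul_zero, mul_zero, sub_zero]
      exact (hasDerivAt_const x 0).congr_of_eventuallyEq h0
  have hi : IntervalIntegrable (fun x => g x * deriv (deriv φ) x - deriv (deriv g) x * φ x)
      volume 0 1 := by
    rw [intervalIntegrable_iff_integrableOn_Icc_of_le zero_le_one]
    exact (hprod'.sub hprod).integrableOn_Icc
  have hftc := intervalIntegral.integral_eq_sub_of_hasDerivAt (fun x _ => hderiv x) hi
  have hend : ∀ x ∉ Ioo (0 : ℝ) 1, g x * deriv φ x - deriv g x * φ x = 0 := fun x hx => by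
    rw [(hnear x hx).eq_of_nhds, (hnear' x hx).eq_of_nhds]
    simp
  rw [hend 1 (by simp), hend 0 (by simp), sub_zero, intervalIntegral.integral_of_le zero_le_one,
    ← integral_Icc_eq_integral_Ioc, integral_sub hprod'.integrableOn_Icc hprod.integrableOn_Icc]
    at hftc
  exact sub_eq_zero.1 hftc

lemma deriv_fst_eq_fderiv {v : ℝ × ℝ → ℝ} {p : ℝ × ℝ} (hv : DifferentiableAt ℝ v p) :
    deriv (fun s => v (s, p.2)) p.1 = fderiv ℝ v p (1, 0) :=
  (hv.hasFDerivAt.comp_hasDerivAt p.1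
    ((hasDerivAt_id p.1).prodMk (hasDerivAt_const p.1 p.2))).deriv

lemma continuousOn_deriv_deriv_fst {v : ℝ × ℝ → ℝ} {U : Set (ℝ × ℝ)} (hU : IsOpen U)
    (hv : ContDiffOn ℝ 2 v U) :
    ContinuousOn (fun p : ℝ × ℝ => deriv (deriv (fun s => v (s, p.2))) p.1) U := by
  set G : ℝ × ℝ → ℝ := fun p => fderiv ℝ v p (1, 0) with hG
  have hG1 : ContDiffOn ℝ 1 G U :=
    (hv.fderiv_of_isOpen hU (by norm_num)).clm_apply contDiffOn_const
  have hc : ContinuousOn (fun p => fderiv ℝ G p (1, 0)) U :=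
    ((hG1.fderiv_of_isOpen (m := 0) hU (by norm_num)).clm_apply contDiffOn_const).continuousOn
  refine hc.congr fun p hp => ?_
  have hnear : deriv (fun s => v (s, p.2)) =ᶠ[nhds p.1] fun s => G (s, p.2) := by
    have hcont : ContinuousAt (fun s : ℝ => (s, p.2)) p.1 := by fun_prop
    filter_upwards [hcont.preimage_mem_nhds (hU.mem_nhds hp)] with s hs
    exact deriv_fst_eq_fderiv (p := (s, p.2))
      ((hv.differentiableOn (by norm_num)).differentiableAt (hU.mem_nhds hs))
  simp only
  rw [hnear.deriv_eq]
  exact deriv_fst_eq_fderiv ((hG1.differentiableOn (by norm_num)).differentiableAt (hU.mem_nhds hp))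

lemma continuous_deriv_deriv_fst_mul_cutoffMode {v : ℝ × ℝ → ℝ}
    (hv : ContDiffOn ℝ 2 v (interior unitSquare)) (n m : ℕ) {k : ℕ} (hk : 0 < k) :
    Continuous (fun p : ℝ × ℝ =>
      deriv (deriv (fun s => v (s, p.2))) p.1 * cutoffMode n m k p) := by
  refine continuous_of_tsupport fun p hp => ?_
  have hp' := tsupport_cutoffMode_subset_interior n m hk (tsupport_mul_subset_right hp)
  exact ((continuousOn_deriv_deriv_fst isOpen_interior hv).continuousAt
    (isOpen_interior.mem_nhds hp')).mul (continuous_cutoffMode n m k).continuousAt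

lemma integral_mul_deriv_deriv_fst {v : ℝ × ℝ → ℝ} (hv : ContinuousOn v unitSquare)
    (hv2 : ContDiffOn ℝ 2 v (interior unitSquare)) (n m : ℕ) {k : ℕ} (hk : 0 < k) :
    ∫ p, v p * (deriv (deriv (cutoffSine n k)) p.1 * cutoffSine m k p.2) ∂squareMeasure =
      ∫ p, deriv (deriv (fun s => v (s, p.2))) p.1 * cutoffMode n m k p ∂squareMeasure := by
  have hm := continuous_cutoffSine m k
  have hnd := continuous_deriv_deriv_cutoffSine n k
  have hi1 : Integrable (fun p : ℝ × ℝ =>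
      v p * (deriv (deriv (cutoffSine n k)) p.1 * cutoffSine m k p.2)) squareMeasure :=
    integrable_squareMeasure_of_continuousOn (hv.mul (by fun_prop))
  have hi2 := integrable_squareMeasure_of_continuousOn
    (continuous_deriv_deriv_fst_mul_cutoffMode hv2 n m hk).continuousOn
  rw [squareMeasure_eq_prod] at hi1 hi2 ⊢
  rw [integral_prod_symm _ hi1, integral_prod_symm _ hi2]
  refine setIntegral_congr_fun measurableSet_Icc fun y hy => ?_
  by_cases hy' : y ∈ Ioo (0 : ℝ) 1
  · have h1 := integral_mul_deriv_deriv_cutoffSine (g := fun x => v (x, y))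
      (hv.comp (by fun_prop) fun x hx => ⟨hx, hy⟩)
      (hv2.comp (by fun_prop) fun x hx => by
        rw [interior_unitSquare]
        exact ⟨hx, hy'⟩) n hk
    have h2 := congrArg (fun t => t * cutoffSine m k y) h1
    simp only [← integral_mul_const] at h2
    simpa only [cutoffMode, mul_assoc] using h2
  · have h0 : cutoffSine m k y = 0 := by
      refine cutoffSine_eq_zero m hk fun h => hy' ?_
      have hk' : (0 : ℝ) < 1 / k := by positivity
      exact ⟨hk'.trans_le h.1, by linarith [h.2]⟩
    simp [cutoffMode, h0]

lemma integral_mul_planeLaplacian_cutoffMode {v : ℝ × ℝ → ℝ} (hv : ContinuousOn v unitSquare)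
    (hv2 : ContDiffOn ℝ 2 v (interior unitSquare)) (n m : ℕ) {k : ℕ} (hk : 0 < k) :
    ∫ p, v p * planeLaplacian (cutoffMode n m k) p ∂squareMeasure =
      ∫ p, planeLaplacian v p * cutoffMode n m k p ∂squareMeasure := by
  have hswap : MapsTo Prod.swap unitSquare unitSquare := fun p hp => ⟨hp.2, hp.1⟩
  have hw : ContinuousOn (fun p => v p.swap) unitSquare :=
    hv.comp continuous_swap.continuousOn hswap
  have hw2 : ContDiffOn ℝ 2 (fun p => v p.swap) (interior unitSquare) := by
    refine hv2.comp (contDiff_snd.prodMk contDiff_fst).contDiffOn fun p hp => ?_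
    rw [interior_unitSquare] at hp ⊢
    exact ⟨hp.2, hp.1⟩
  have h1 := integral_mul_deriv_deriv_fst hv hv2 n m hk
  have h2 := integral_mul_deriv_deriv_fst hw hw2 m n hk
  have hc1 := continuous_deriv_deriv_fst_mul_cutoffMode hv2 n m hk
  have hc2 := (continuous_deriv_deriv_fst_mul_cutoffMode hw2 m n hk).comp continuous_swap
  rw [← integral_squareMeasure_swap, ← integral_squareMeasure_swap (fun p => deriv _ _ * _)] at h2
  simp only [Function.comp_def, Prod.fst_swap, Prod.snd_swap, Prod.swap_swap, Prod.swap_prod_mk]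
    at h2 hc2
  have hmode : ∀ p : ℝ × ℝ, cutoffMode m n k p.swap = cutoffMode n m k p := fun p => by
    simp only [cutoffMode, Prod.fst_swap, Prod.snd_swap]
    ring
  simp only [hmode] at h2 hc2
  have hn := continuous_cutoffSine n k
  have hm := continuous_cutoffSine m k
  have hnd := continuous_deriv_deriv_cutoffSine n k
  have hmd := continuous_deriv_deriv_cutoffSine m k
  have h3 := congrArg₂ (· + ·) h1 h2
  rw [← integral_add, ← integral_add] at h3
  · convert! h3 using 1
    · refine integral_congr_ae (Filter.Eventually.of_forall fun p => ?_)
      simp only [planeLaplacian_cutoffMode]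
      ring
    · refine integral_congr_ae (Filter.Eventually.of_forall fun p => ?_)
      simp only [planeLaplacian, iteratedDeriv_succ, iteratedDeriv_zero]
      ring
  · exact integrable_squareMeasure_of_continuousOn hc1.continuousOn
  · exact integrable_squareMeasure_of_continuousOn hc2.continuousOn
  · exact integrable_squareMeasure_of_continuousOn (hv.mul (by fun_prop))
  · exact integrable_squareMeasure_of_continuousOn (hv.mul (by fun_prop))

/-- A classical solution satisfies the equation in the weak form. -/
lemma IsClassicalSolution.integral_mul_cutoffMode {f : C(unitSquare, ℝ)} {v : ℝ × ℝ → ℝ}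
    (hv : IsClassicalSolution f v) (n m : ℕ) {k : ℕ} (hk : 0 < k) :
    ∫ p : unitSquare, f p * cutoffMode n m k p ∂(volume.comap Subtype.val) =
      ∫ p, v p * planeLaplacian (cutoffMode n m k) p ∂squareMeasure := by
  rw [integral_mul_planeLaplacian_cutoffMode hv.continuousOn hv.contDiffOn n m hk,
    ← integral_subtype_comap measurableSet_unitSquare]
  refine integral_congr_ae (Filter.Eventually.of_forall fun p => ?_)
  by_cases hp : (p : ℝ × ℝ) ∈ interior unitSquare
  · simp only [hv.equation p hp]
  · have h0 : cutoffMode n m k p = 0 := by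
      by_contra h
      exact hp (tsupport_cutoffMode_subset_interior n m hk (subset_tsupport _ h))
    simp only [h0, mul_zero]

/-! ### The sine coefficient as a function of the forcing plus noise -/

instance isProbabilityMeasure_comap_unitSquare :
    IsProbabilityMeasure ((volume : Measure (ℝ × ℝ)).comap (Subtype.val : unitSquare → ℝ × ℝ)) := by
  constructor
  rw [comap_subtype_coe_apply measurableSet_unitSquare, image_univ, Subtype.range_coe]
  rw [← Measure.restrict_apply_univ]
  exact measure_univ (μ := squareMeasure)

/-- The sine coefficient of a forcing function. The integral is over the square as a subtype, since
the forcing is only defined there. -/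
noncomputable def forcingCoeff (n m : ℕ) (f : C(unitSquare, ℝ)) : ℝ :=
  ∫ p : unitSquare, f p * sineMode n m p ∂(volume.comap Subtype.val)

lemma continuous_forcingCoeff (n m : ℕ) : Continuous (forcingCoeff n m) := by
  have : CompactSpace unitSquare := isCompact_iff_compactSpace.1 isCompact_unitSquare
  have hi : ∀ f : C(unitSquare, ℝ), Integrable (fun p : unitSquare => f p * sineMode n m p)
      (volume.comap Subtype.val) := fun f => by
    refine Integrable.of_bound (((f.continuous).mul
      ((continuous_sineMode n m).comp continuous_subtype_val)).aestronglyMeasurable) ‖f‖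
      (Filter.Eventually.of_forall fun p => ?_)
    rw [norm_mul]
    exact (mul_le_of_le_one_right (norm_nonneg _) (abs_sineMode_le_one n m p)).trans
      (f.norm_coe_le_norm p)
  refine LipschitzWith.continuous (K := 1) (LipschitzWith.of_dist_le_mul fun f g => ?_)
  rw [NNReal.coe_one, one_mul, dist_eq_norm, dist_eq_norm, forcingCoeff, forcingCoeff,
    ← integral_sub (hi f) (hi g)]
  have h := norm_integral_le_of_norm_le_const (C := ‖f - g‖)
    (μ := (volume : Measure (ℝ × ℝ)).comap (Subtype.val : unitSquare → ℝ × ℝ))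
    (f := fun p : unitSquare => f p * sineMode n m p - g p * sineMode n m p)
    (Filter.Eventually.of_forall fun p => by
      rw [← sub_mul, norm_mul]
      exact (mul_le_of_le_one_right (norm_nonneg _) (abs_sineMode_le_one n m p)).trans
        ((f - g).norm_coe_le_norm p))
  simpa using h

lemma tendsto_integral_mul_cutoffMode (f : C(unitSquare, ℝ)) (n m : ℕ) :
    Filter.Tendsto
      (fun k => ∫ p : unitSquare, f p * cutoffMode n m k p ∂(volume.comap Subtype.val))
      Filter.atTop (nhds (forcingCoeff n m f)) := by
  have : CompactSpace unitSquare := isCompact_iff_compactSpace.1 isCompact_unitSquare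
  refine tendsto_integral_of_dominated_convergence (fun _ => ‖f‖) (fun k => ?_)
    (integrable_const _) (fun k => ?_) ?_
  · exact (f.continuous.mul
      ((continuous_cutoffMode n m k).comp continuous_subtype_val)).aestronglyMeasurable
  · refine Filter.Eventually.of_forall fun p => ?_
    rw [norm_mul]
    exact (mul_le_of_le_one_right (norm_nonneg _) (abs_cutoffMode_le_one n m k p)).trans
      (f.norm_coe_le_norm p)
  · exact Filter.Eventually.of_forall fun p => (tendsto_cutoffMode n m p.2).const_mul _

/-- The sine coefficient of the classical solution is determined by that of the forcing. In
particular it depends on the sample point through the forcing only. -/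
lemma IsClassicalSolution.integral_mul_sineMode {f : C(unitSquare, ℝ)} {v : ℝ × ℝ → ℝ}
    (hv : IsClassicalSolution f v) (n m : ℕ) :
    forcingCoeff n m f = -(Real.pi ^ 2 * ((n : ℝ) ^ 2 + (m : ℝ) ^ 2) *
      ∫ p, v p * sineMode n m p ∂squareMeasure) := by
  refine tendsto_nhds_unique ((tendsto_integral_mul_cutoffMode f n m).congr' ?_)
    (tendsto_integral_mul_planeLaplacian_cutoffMode hv.continuousOn hv.boundary n m)
  filter_upwards [Filter.eventually_gt_atTop 0] with k hk
  exact hv.integral_mul_cutoffMode n m hk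

lemma tendsto_integral_cutoffMode_sub_sq (n m : ℕ) :
    Filter.Tendsto (fun k => ∫ p, (cutoffMode n m k p - sineMode n m p) ^ 2 ∂squareMeasure)
      Filter.atTop (nhds 0) := by
  have h : Filter.Tendsto
      (fun k => ∫ p, (cutoffMode n m k p - sineMode n m p) ^ 2 ∂squareMeasure)
      Filter.atTop (nhds (∫ _, (0 : ℝ) ∂squareMeasure)) := by
    refine tendsto_integral_of_dominated_convergence (fun _ => 2 ^ 2) (fun k => ?_)
      (integrable_const _) (fun k => ?_) ?_
    · exact (((continuous_cutoffMode n m k).sub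
        (continuous_sineMode n m)).pow 2).aestronglyMeasurable
    · refine Filter.Eventually.of_forall fun p => ?_
      rw [norm_pow]
      refine pow_le_pow_left₀ (norm_nonneg _) ?_ 2
      refine (norm_sub_le _ _).trans ?_
      have h1 : ‖cutoffMode n m k p‖ ≤ 1 := abs_cutoffMode_le_one n m k p
      have h2 : ‖sineMode n m p‖ ≤ 1 := abs_sineMode_le_one n m p
      linarith
    · filter_upwards [ae_restrict_mem measurableSet_unitSquare] with p hp
      simpa using ((tendsto_cutoffMode n m hp).sub_const (sineMode n m p)).pow 2
  simpa using h

/-- Convergence in `L²` implies almost sure convergence along a subsequence. -/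
lemma exists_subseq_tendsto_of_integral_sub_sq {α : Type*} [MeasurableSpace α] {ν : Measure α}
    {N : ℕ → α → ℝ} {M : α → ℝ} (hN : ∀ k, MemLp (N k) 2 ν) (hM : MemLp M 2 ν)
    (h : Filter.Tendsto (fun k => ∫ x, (N k x - M x) ^ 2 ∂ν) Filter.atTop (nhds 0)) :
    ∃ ns : ℕ → ℕ, StrictMono ns ∧
      ∀ᵐ x ∂ν, Filter.Tendsto (fun i => N (ns i) x) Filter.atTop (nhds (M x)) := by
  have hi : ∀ k, Integrable (fun x => (N k x - M x) ^ 2) ν := fun k =>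
    ((hN k).sub hM).integrable_sq
  have hmeas : TendstoInMeasure ν (fun k x => (N k x - M x) ^ 2) Filter.atTop (fun _ => 0) := by
    refine tendstoInMeasure_of_tendsto_eLpNorm one_ne_zero (fun k => (hi k).1)
      aestronglyMeasurable_const ?_
    have h1 : ∀ k, eLpNorm ((fun x => (N k x - M x) ^ 2) - fun _ => 0) 1 ν =
        ENNReal.ofReal (∫ x, (N k x - M x) ^ 2 ∂ν) := fun k => by
      rw [eLpNorm_one_eq_lintegral_enorm, ofReal_integral_eq_lintegral_ofReal (hi k)
        (Filter.Eventually.of_forall fun x => sq_nonneg _)]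
      refine lintegral_congr fun x => ?_
      simp only [Pi.sub_apply, sub_zero]
      exact Real.enorm_of_nonneg (sq_nonneg _)
    simp only [h1]
    simpa using ENNReal.tendsto_ofReal h
  obtain ⟨ns, hns, hae⟩ := hmeas.exists_seq_tendsto_ae
  refine ⟨ns, hns, ?_⟩
  filter_upwards [hae] with x hx
  have h1 : Filter.Tendsto (fun i => |N (ns i) x - M x|) Filter.atTop (nhds 0) := by
    have h2 := (Real.continuous_sqrt.tendsto _).comp hx
    simpa [Function.comp_def, Real.sqrt_sq_eq_abs] using h2
  exact tendsto_sub_nhds_zero_iff.1 ((tendsto_zero_iff_abs_tendsto_zero _).2 h1)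

section SineCoefficient

variable {Ω : Type*} [MeasurableSpace Ω] {P : Measure Ω} [IsProbabilityMeasure P] {σ : ℝ}
  {W : SquareL2 → Ω → ℝ} {f₀ : Ω → C(unitSquare, ℝ)} {u u₀ : Ω → ℝ × ℝ → ℝ}

lemma measurable_sineCoeff (hu : Measurable (Function.uncurry u)) (n m : ℕ) :
    Measurable (sineCoeff u n m) :=
  measurable_average (μ := squareMeasure) hu (continuous_sineMode n m).measurable

lemma pi_sq_mul_pos {n : ℕ} (hn : 0 < n) (m : ℕ) :
    0 < Real.pi ^ 2 * ((n : ℝ) ^ 2 + (m : ℝ) ^ 2) := by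
  have : (0 : ℝ) < n := Nat.cast_pos.2 hn
  positivity

/-- The weak equation extends from compactly supported test functions to the sine modes. -/
lemma IsDirichletSolution.forcingCoeff_ae_eq (hW : IsWhiteNoise P σ W)
    (hu : IsDirichletSolution P W f₀ u) (n m : ℕ) :
    ∀ᵐ ω ∂P, forcingCoeff n m (f₀ ω) =
      -(Real.pi ^ 2 * ((n : ℝ) ^ 2 + (m : ℝ) ^ 2) * sineCoeff u n m ω) +
        noiseIntegral W (sineMode n m) ω := by
  have hmk : ∀ k, MemLp (cutoffMode n m k) 2 squareMeasure := fun k =>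
    memLp_two_of_continuous (continuous_cutoffMode n m k) (abs_cutoffMode_le_one n m k)
  have hms : MemLp (sineMode n m) 2 squareMeasure :=
    memLp_two_of_continuous (continuous_sineMode n m) (abs_sineMode_le_one n m)
  have hL2 : Filter.Tendsto (fun k => ∫ ω, (noiseIntegral W (cutoffMode n m k) ω -
      noiseIntegral W (sineMode n m) ω) ^ 2 ∂P) Filter.atTop (nhds 0) := by
    simp only [fun k => hW.integral_sub_sq_noiseIntegral (hmk k) hms]
    simpa using (tendsto_integral_cutoffMode_sub_sq n m).const_mul (σ ^ 2)
  obtain ⟨ns, hns, hae⟩ := exists_subseq_tendsto_of_integral_sub_sq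
    (fun k => hW.memLp_noiseIntegral (hmk k)) (hW.memLp_noiseIntegral hms) hL2
  have heq : ∀ᵐ ω ∂P, ∀ k, 0 < k →
      ∫ p : unitSquare, f₀ ω p * cutoffMode n m k p ∂(volume.comap Subtype.val) =
        (∫ p in unitSquare, u ω p * planeLaplacian (cutoffMode n m k) p) +
          noiseIntegral W (cutoffMode n m k) ω := by
    refine ae_all_iff.2 fun k => ?_
    by_cases hk : 0 < k
    · filter_upwards [hu.equation (cutoffMode n m k) (contDiff_cutoffMode n m k)
        (hasCompactSupport_cutoffMode n m hk) (tsupport_cutoffMode_subset_interior n m hk)]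
        with ω hω _ using hω
    · exact Filter.Eventually.of_forall fun ω h => absurd h hk
  filter_upwards [hu.continuousOn, hu.boundary, hae, heq] with ω hc hb hN hE
  have h1 := (tendsto_integral_mul_cutoffMode (f₀ ω) n m).comp hns.tendsto_atTop
  have h2 := (tendsto_integral_mul_planeLaplacian_cutoffMode hc hb n m).comp hns.tendsto_atTop
  refine tendsto_nhds_unique h1 ((h2.add hN).congr' ?_)
  filter_upwards [hns.tendsto_atTop.eventually_gt_atTop 0] with i hi
  exact (hE (ns i) hi).symm

/-- In the Newtonian model the sine coefficient is that of the classical solution minus the noise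
integral of the Newtonian potential of the mode; moreover the paths are integrable. -/
lemma IsNewtonianModel.sineCoeff_ae_eq (hW : IsWhiteNoise P σ W)
    (hu : IsNewtonianModel P W f₀ u₀ u) (n m : ℕ) :
    (∀ᵐ ω ∂P, IntegrableOn (u ω) unitSquare) ∧
      ∀ᵐ ω ∂P, sineCoeff u n m ω = sineCoeff u₀ n m ω -
        noiseIntegral W (fun q => ∫ p, psi (q - p) * sineMode n m p ∂squareMeasure) ω := by
  set Z : Ω × (ℝ × ℝ) → ℝ := fun x => u₀ x.1 x.2 - u x.1 x.2 with hZdef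
  have hZ : Measurable Z := hu.measurable_mean.sub hu.measurable
  have hK : Measurable (fun x : (ℝ × ℝ) × (ℝ × ℝ) => psi (x.1 - x.2)) :=
    measurable_psi.comp (by fun_prop)
  have hKC : ∀ᵐ p ∂squareMeasure, MemLp (fun q => psi (q - p)) 2 squareMeasure ∧
      ∫ q, psi (q - p) ^ 2 ∂squareMeasure ≤ ∫ t in Icc (-1) 1, (|Real.log t| + 1) ^ 2 := by
    filter_upwards [ae_restrict_mem measurableSet_unitSquare] with p hp
    exact memLp_two_psi_sub hp
  have hZK : ∀ᵐ p ∂squareMeasure,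
      (fun ω => Z (ω, p)) =ᵐ[P] noiseIntegral W (fun q => psi (q - p)) := by
    filter_upwards [ae_restrict_mem measurableSet_unitSquare] with p hp
    filter_upwards [hu.representation p hp] with ω hω
    simp only [hZdef, hω]
    ring
  have hsec := ae_memLp_two_section hZ (hW.memLp_two_field
    (K := fun x => psi (x.1 - x.2)) hZ hKC hZK)
  have havg := hW.average_ae_eq_noiseIntegral (K := fun x => psi (x.1 - x.2)) hZ hK hKC hZK
    (continuous_sineMode n m).measurable (abs_sineMode_le_one n m)
  have hint : ∀ᵐ ω ∂P, IntegrableOn (u₀ ω) unitSquare ∧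
      Integrable (fun p => Z (ω, p)) squareMeasure := by
    filter_upwards [hu.mean_solution, hsec] with ω h1 h2
    exact ⟨integrable_squareMeasure_of_continuousOn h1.continuousOn,
      h2.integrable one_le_two⟩
  have hu_eq : ∀ ω p, u ω p = u₀ ω p - Z (ω, p) := fun ω p => by
    simp only [hZdef]
    ring
  constructor
  · filter_upwards [hint] with ω hω
    exact (hω.1.sub hω.2).congr (Filter.Eventually.of_forall fun p => (hu_eq ω p).symm)
  · filter_upwards [hint, havg] with ω hω hav
    rw [← hav, sineCoeff, sineCoeff, ← integral_sub]
    · refine integral_congr_ae (Filter.Eventually.of_forall fun p => ?_)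
      simp only [hu_eq ω p]
      ring
    · exact Integrable.mul_bdd (c := 1) hω.1 (continuous_sineMode n m).aestronglyMeasurable
        (Filter.Eventually.of_forall (abs_sineMode_le_one n m))
    · exact Integrable.mul_bdd (c := 1) hω.2 (continuous_sineMode n m).aestronglyMeasurable
        (Filter.Eventually.of_forall (abs_sineMode_le_one n m))

/-- If the sine coefficient is a function of the forcing plus a multiple of a noise integral, then
its conditional variance is that of the noise term. -/
lemma memLp_and_variance_condDistrib_le (hW : IsWhiteNoise P σ W) (hf₀ : Measurable f₀)
    (hindep : IndepFun f₀ (fun ω h => W h ω) P) {F : C(unitSquare, ℝ) → ℝ} (hF : Measurable F)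
    {Y : Ω → ℝ} (hY : Measurable Y) {h : ℝ × ℝ → ℝ} (hh : MemLp h 2 squareMeasure) (c : ℝ)
    (hYF : ∀ᵐ ω ∂P, Y ω = F (f₀ ω) + c * noiseIntegral W h ω) {B : ℝ}
    (hB : c ^ 2 * ∫ q, h q ^ 2 ∂squareMeasure ≤ B ^ 2) :
    ∀ᵐ g ∂(P.map f₀), MemLp id 2 (condDistrib Y f₀ P g) ∧
      Var[id; condDistrib Y f₀ P g] ≤ B ^ 2 * σ ^ 2 := by
  have hX := hW.measurable_noiseIntegral h
  have hind : IndepFun f₀ (fun ω => c * noiseIntegral W h ω) P :=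
    (indepFun_noiseIntegral hindep hh).comp measurable_id (measurable_const_mul c)
  filter_upwards [memLp_and_variance_condDistrib_of_indepFun hf₀ hF (hX.const_mul c)
    ((hW.memLp_noiseIntegral hh).const_mul c) hY hind hYF] with g hg
  refine ⟨hg.1, hg.2.trans_le ?_⟩
  rw [variance_const_mul, hW.variance_noiseIntegral hh]
  calc _ = c ^ 2 * (∫ q, h q ^ 2 ∂squareMeasure) * σ ^ 2 := by ring
    _ ≤ _ := by gcongr

end SineCoefficient

theorem theorem2 {Ω : Type*} [MeasurableSpace Ω] (P : Measure Ω) [IsProbabilityMeasure P]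
    (σ : ℝ) (W : SquareL2 → Ω → ℝ) (hW : IsWhiteNoise P σ W)
    (f₀ : Ω → C(unitSquare, ℝ)) (hf₀ : Measurable f₀)
    (hindep : IndepFun f₀ (fun ω h => W h ω) P)
    (u : Ω → ℝ × ℝ → ℝ)
    (hu : IsDirichletSolution P W f₀ u ∨ ∃ u₀ : Ω → ℝ × ℝ → ℝ, IsNewtonianModel P W f₀ u₀ u)
    (n m : ℕ) (hn : 0 < n) (hm : 0 < m) :
    (∀ᵐ ω ∂P, IntegrableOn (u ω) unitSquare) ∧ Measurable (sineCoeff u n m) ∧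
      ∀ᵐ g ∂(P.map f₀),
        MemLp id 2 (condDistrib (sineCoeff u n m) f₀ P g) ∧
        Var[id; condDistrib (sineCoeff u n m) f₀ P g] ≤
          (1 / (Real.pi ^ 2 * ((n : ℝ) ^ 2 + (m : ℝ) ^ 2)) +
            Real.log 2 * max (n : ℝ) (m : ℝ)) ^ 2 * σ ^ 2 := by
  have hlam := pi_sq_mul_pos hn m
  have hm1 : (1 : ℝ) ≤ max (n : ℝ) (m : ℝ) := le_max_of_le_left (Nat.one_le_cast.2 hn)
  have hlog : 0 < Real.log 2 := Real.log_pos one_lt_two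
  have hF : Measurable (fun f => -(1 / (Real.pi ^ 2 * ((n : ℝ) ^ 2 + (m : ℝ) ^ 2))) *
      forcingCoeff n m f) := ((continuous_forcingCoeff n m).measurable).const_mul _
  -- in both cases the coefficient is this function of the forcing plus an independent noise term
  rcases hu with hu | ⟨u₀, hu⟩
  · have hmeas := measurable_sineCoeff hu.measurable n m
    have hms : MemLp (sineMode n m) 2 squareMeasure :=
      memLp_two_of_continuous (continuous_sineMode n m) (abs_sineMode_le_one n m)
    refine ⟨?_, hmeas, ?_⟩
    · filter_upwards [hu.continuousOn] with ω hω
      exact integrable_squareMeasure_of_continuousOn hω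
    · refine memLp_and_variance_condDistrib_le hW hf₀ hindep hF hmeas hms
        (1 / (Real.pi ^ 2 * ((n : ℝ) ^ 2 + (m : ℝ) ^ 2))) ?_ ?_
      · filter_upwards [hu.forcingCoeff_ae_eq hW n m] with ω hω
        rw [hω]
        field_simp
        ring
      · have hone : ∫ q, sineMode n m q ^ 2 ∂squareMeasure ≤ 1 := by
          have h := norm_integral_le_of_norm_le_const (μ := squareMeasure) (C := 1)
            (f := fun q => sineMode n m q ^ 2) (Filter.Eventually.of_forall fun q => by
              rw [norm_pow]
              exact pow_le_one₀ (norm_nonneg _) (abs_sineMode_le_one n m q))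
          simp only [probReal_univ, mul_one] at h
          exact (le_abs_self _).trans h
        refine (mul_le_of_le_one_right (sq_nonneg _) hone).trans ?_
        refine pow_le_pow_left₀ (by positivity) (le_add_of_nonneg_right (by positivity)) 2
  · have hmeas := measurable_sineCoeff hu.measurable n m
    obtain ⟨hint, hcoeff⟩ := hu.sineCoeff_ae_eq hW n m
    refine ⟨hint, hmeas, ?_⟩
    have hh : MemLp (fun q => ∫ p, psi (q - p) * sineMode n m p ∂squareMeasure) 2
        squareMeasure := by
      refine MemLp.of_bound (measurable_average (F := fun x => psi (x.1 - x.2))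
        (measurable_psi.comp (by fun_prop))
        (continuous_sineMode n m).measurable).aestronglyMeasurable (Real.log 2) ?_
      filter_upwards [ae_restrict_mem measurableSet_unitSquare] with q hq
      exact abs_integral_psi_mul_le hq (abs_sineMode_le_one n m)
    refine memLp_and_variance_condDistrib_le hW hf₀ hindep hF hmeas hh (-1) ?_ ?_
    · filter_upwards [hcoeff, hu.mean_solution] with ω h1 h2
      rw [h1, h2.integral_mul_sineMode n m, sineCoeff]
      field_simp
      ring
    · rw [neg_one_sq, one_mul]
      refine (integral_sq_integral_psi_mul_le (abs_sineMode_le_one n m)).trans ?_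
      refine pow_le_pow_left₀ hlog.le ?_ 2
      have h1 : Real.log 2 ≤ Real.log 2 * max (n : ℝ) (m : ℝ) :=
        le_mul_of_one_le_right hlog.le hm1
      have h2 : 0 < 1 / (Real.pi ^ 2 * ((n : ℝ) ^ 2 + (m : ℝ) ^ 2)) := one_div_pos.2 hlam
      linarith
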